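/- **Theorem 1.** Let $\mathcal X,\mathcal S,\mathcal Y,\mathcal Z,\hat{\mathcal S}$ be finite alphabets, $P_S$ a probability mass function on $\mathcal S$, $P_{YZ|XS}$ a conditional probability mass function, $d:\mathcal S\times\hat{\mathcal S}\to[0,\infty)$ a distortion function, and $D\in\mathbb R$. An $(M,n)$ code consists of encoding functions $x_i=\phi_i(w,z^{i-1})\in\mathcal X$, $1\le i\le n$, for $w\in\{1,\dots,M\}$ (the transmitter sees the feedback $Z$ strictly causally), a decoder $\hat w=g(y^n,s^n)\in\{1,\dots,M\}$ (the receiver knows the state), and a state estimator $\hat s^n=h(x^n,z^n)\in\hat{\mathcal S}^n$ at the transmitter. With $W$ uniform on $\{1,\dots,M\}$ and $x_i=\phi_i(w,z^{i-1})$, the induced law (memoryless channel, i.i.d. states) is $$P(w,s^n,y^n,z^n)=\frac1M\prod_{i=1}^nP_S(s_i)\prod_{i=1}^nP_{YZ|XS}(y_i,z_i|x_i,s_i),$$ and the expected distortion is $\mathbb E[d(S^n,\hat S^n)]=\frac1n\sum_{i=1}^n\mathbb E[d(S_i,\hat S_i)]$. A pair $(R,D)$ with $R\ge0$ is achievable if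 there are $(\lfloor2^{nR}\rfloor,n)$ codes, $n=1,2,\dots$, with $\lim_{n\to\infty}P(\hat W\ne W)=0$ and $\limsup_{n\to\infty}\mathbb E[d(S^n,\hat S^n)]\le D$. The capacity-distortion tradeoff $C(D)$ is the supremum of all $R$ such that $(R,D)$ is achievable. Call a pair $(P_X,P_{\hat S|XZ})$ of a probability mass function on $\mathcal X$ and a conditional probability mass function feasible for $D$ if $\mathbb E[d(S,\hat S)]\le D$ when $(S,X,Y,Z,\hat S)$ has the law $$P_X(x)\,P_S(s)\,P_{YZ|XS}(y,z|x,s)\,P_{\hat S|XZ}(\hat s|x,z).$$ If a feasible pair exists, then the supremum $C(D)$ is finite and $$C(D)=\max I(X;Y|S),$$ where the maximum, in bits, is over all feasible pairs $(P_X,P_{\hat S|XZ})$ and is attained. Moreover, there is a deterministic Bayes estimator $$\hat s(x,z)\in\arg\min_{s'\in\hat{\mathcal S}}\sum_{s\in\mathcal S}P_{S|XZ}(s|x,z)\,d(s,s'),$$ where $P_{S|XZ}(s|x,z)\propto P_S(s)\sum_yP_{YZ|XS}(y,z|x,s)$ (any value of $\hat s(x,z)$ is allowed where this is $0$ for all $s$),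 and for each such estimator the maximum is unchanged if it is taken only over those $P_X$ that satisfy $\mathbb E[d(S,\hat s(X,Z))]\le D$. If no feasible pair exists, then no pair $(R,D)$ is achievable. -/

import Mathlib

open Filter Topology

noncomputable section

namespace JointSensing

/-- A memoryless state-dependent channel with generalized feedback and i.i.d. states, on finite
alphabets `X` (input), `S` (state), `Y` (output), `Z` (feedback): the state law `P_S` and the
transition law `P_{YZ|XS}`, where `trans x s (y, z)` is `P_{YZ|XS}(y,z|x,s)`. -/
structure Channel (X S Y Z : Type*) [Fintype S] [Fintype Y] [Fintype Z] where
  stateLaw : S → ℝ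
  stateLaw_mem : stateLaw ∈ stdSimplex ℝ S
  trans : X → S → Y × Z → ℝ
  trans_mem : ∀ x s, trans x s ∈ stdSimplex ℝ (Y × Z)

/-- A code of block length `n` with `M` messages: an encoder sending
`x_i = φ_i(w, z^{i-1})`, a decoder `ŵ = g(y^n, s^n)` and a state estimator
`ŝ^n` depending on `(x^n, z^n)`. -/
structure Code (X S Y Z Shat : Type*) (n M : ℕ) where
  enc : (i : Fin n) → Fin M → (Fin i → Z) → X
  dec : (Fin n → Y) → (Fin n → S) → Fin M
  est : (Fin n → X) → (Fin n → Z) → Fin n → Shat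

section Operational

variable {X S Y Z Shat : Type*} [Fintype S] [Fintype Y] [Fintype Z] {n M : ℕ}

/-- The channel input sequence `x^n` for message `w` and feedback sequence `z^n`; its `i`-th letter
only uses the strict past of the feedback. -/
def Code.input (c : Code X S Y Z Shat n M) (w : Fin M) (z : Fin n → Z) : Fin n → X :=
  fun i => c.enc i w (fun j => z (Fin.castLE i.isLt.le j))

/-- The joint probability of `(W, S^n, Y^n, Z^n) = (w, s, y, z)`, with `W` uniform on the messages
(and `X^n` equal to `c.input W Z^n`). -/
def Code.law (c : Code X S Y Z Shat n M) (ch : Channel X S Y Z)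
    (w : Fin M) (s : Fin n → S) (y : Fin n → Y) (z : Fin n → Z) : ℝ :=
  (M : ℝ)⁻¹ * (∏ i, ch.stateLaw (s i)) * ∏ i, ch.trans (c.input w z i) (s i) (y i, z i)

/-- The error probability `P(Ŵ ≠ W)`. -/
def Code.errorProb (c : Code X S Y Z Shat n M) (ch : Channel X S Y Z) : ℝ :=
  ∑ w, ∑ s, ∑ y, ∑ z, if c.dec y s ≠ w then c.law ch w s y z else 0

/-- The expected distortion `E[d(S^n, Ŝ^n)] = (1/n) ∑ i, E[d(S_i, Ŝ_i)]`. -/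
def Code.distortion (c : Code X S Y Z Shat n M) (ch : Channel X S Y Z) (d : S → Shat → ℝ) : ℝ :=
  (n : ℝ)⁻¹ * ∑ i, ∑ w, ∑ s, ∑ y, ∑ z,
    c.law ch w s y z * d (s i) (c.est (c.input w z) z i)

/-- `(R, D)` is achievable: there are `(2^{nR}, n)` codes with vanishing error probability and
`limsup E[d(S^n, Ŝ^n)] ≤ D`. The message set `[1 : 2^{nR}]` has `⌊2^{nR}⌋` elements. -/
def Achievable (ch : Channel X S Y Z) (d : S → Shat → ℝ) (R D : ℝ) : Prop :=
  0 ≤ R ∧ ∃ c : (n : ℕ) → Code X S Y Z Shat n ⌊(2 : ℝ) ^ ((n : ℝ) * R)⌋₊,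
    Tendsto (fun n => (c n).errorProb ch) atTop (𝓝 0) ∧
    limsup (fun n => (c n).distortion ch d) atTop ≤ D

/-- The capacity-distortion tradeoff `C(D)`, the supremum of the rates achievable at
distortion `D`. -/
def capacityDistortion (ch : Channel X S Y Z) (d : S → Shat → ℝ) (D : ℝ) : ℝ :=
  sSup {R : ℝ | Achievable ch d R D}

end Operational

section SingleLetter

/-- Conditional mutual information `I(A;B|C)` in bits of a joint law `p a b c` on finite
alphabets. A term with `p a b c = 0` vanishes. -/
def condMutualInfo {A B C : Type*} [Fintype A] [Fintype B] [Fintype C] (p : A → B → C → ℝ) : ℝ :=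
  ∑ a, ∑ b, ∑ c, p a b c *
    Real.logb 2 ((p a b c * ∑ a', ∑ b', p a' b' c) / ((∑ b', p a b' c) * ∑ a', p a' b c))

variable {X S Y Z Shat : Type*} [Fintype X] [Fintype S] [Fintype Y] [Fintype Z] [Fintype Shat]

/-- A conditional law `P_{Ŝ|XZ}`, with `Q x z a` standing for `P_{Ŝ|XZ}(a|x,z)`. -/
def IsEstimatorKernel (Q : X → Z → Shat → ℝ) : Prop :=
  ∀ x z, Q x z ∈ stdSimplex ℝ Shat

/-- The joint law `P_X(x) P_S(s) P_{YZ|XS}(y,z|x,s) P_{Ŝ|XZ}(a|x,z)` of `(S,X,Y,Z,Ŝ)`. -/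
def jointLaw (ch : Channel X S Y Z) (PX : X → ℝ) (Q : X → Z → Shat → ℝ)
    (s : S) (x : X) (y : Y) (z : Z) (a : Shat) : ℝ :=
  PX x * ch.stateLaw s * ch.trans x s (y, z) * Q x z a

/-- `I(X;Y|S)` under the joint law. -/
def mutualInfoXYgivenS (ch : Channel X S Y Z) (PX : X → ℝ) (Q : X → Z → Shat → ℝ) : ℝ :=
  condMutualInfo fun (x : X) (y : Y) (s : S) => ∑ z, ∑ a, jointLaw ch PX Q s x y z a

/-- `E[d(S,Ŝ)]` under the joint law. -/
def expectedDistortion (ch : Channel X S Y Z) (d : S → Shat → ℝ)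
    (PX : X → ℝ) (Q : X → Z → Shat → ℝ) : ℝ :=
  ∑ s, ∑ x, ∑ y, ∑ z, ∑ a, jointLaw ch PX Q s x y z a * d s a

/-- The input laws `P_X`, with a conditional law `P_{Ŝ|XZ}`, for which `E[d(S,Ŝ)] ≤ D`. -/
def Feasible (ch : Channel X S Y Z) (d : S → Shat → ℝ) (D : ℝ)
    (PX : X → ℝ) (Q : X → Z → Shat → ℝ) : Prop :=
  PX ∈ stdSimplex ℝ X ∧ IsEstimatorKernel Q ∧ expectedDistortion ch d PX Q ≤ D

open Classical in
/-- The conditional law of the deterministic estimate `Ŝ = f(X,Z)`. -/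
def deterministicKernel (f : X → Z → Shat) : X → Z → Shat → ℝ :=
  fun x z a => if a = f x z then 1 else 0

/-- The posterior `P_{S|XZ}(s|x,z)`. As `X` and `S` are independent it does not depend on `P_X`;
it is `0` by convention where the output `z` has probability zero given `x`. -/
def posterior (ch : Channel X S Y Z) (x : X) (z : Z) (s : S) : ℝ :=
  (ch.stateLaw s * ∑ y, ch.trans x s (y, z)) /
    ∑ s', ch.stateLaw s' * ∑ y, ch.trans x s' (y, z)

/-- `f` is a deterministic Bayes estimator: `f x z` minimizes the posterior expected distortion. -/
def IsBayesEstimator (ch : Channel X S Y Z) (d : S → Shat → ℝ) (f : X → Z → Shat) : Prop :=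
  ∀ x z a, ∑ s, posterior ch x z s * d s (f x z) ≤ ∑ s, posterior ch x z s * d s a

end SingleLetter

end JointSensing

end

/-!
The capacity-distortion tradeoff of a memoryless channel with state known to the receiver and
feedback to the transmitter is the maximum of `I(X;Y|S)` under the distortion constraint.

The distortion depends on the input law alone. Given the inputs and the feedback the states are
independent, each with the posterior law of its own letter, so a letterwise Bayes estimator `f` is
optimal (`IsBayesEstimator.sum_inputCost_le`, `Code.expect_bayes_le`), and the constraint becomes
linear in the input law: `∑ x, P x * inputCost ch d f x ≤ D`. It cuts out a compact set of input
laws, on which the continuous function `I(X;Y|S)` (`infoNats`, in nats) attains its maximum.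

*Converse* (`Code.fano`, `Achievable.exists_inputLaw`). Let `P` be the input law of a code averaged
over the block and `q(y|s)` the output law it induces. Compare the true law with `Code.refLaw`, where
`Y_i` is drawn from `q(·|s_i)` and `Z_i` from `P_{Z|XSY}`. The log-likelihood ratio of the two laws
is a sum over the letters of `log (P_{Y|XS} / q)`, and its mean is exactly `n I(X;Y|S)` at `P`,
because the mean of a letterwise function only depends on the averaged input law; feedback plays no
role and no concavity is needed. Under the comparison law the message is independent of the
observation, so the guess is right with probability at most `1 / M`. The variational inequality
`E[log (law / refLaw)] ≥ E[g] + 1 - ∑ refLaw * exp g`, for `g = log M` on correct decoding and `0`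
otherwise, then gives `(1 - P_e) log M - 1 ≤ n I(X;Y|S)`. A limit point of the averaged input laws of
a sequence of codes meets the constraint and bounds the rate.

*Achievability* (`achievable_of_lt_infoNats`). Draw the codebook i.i.d. from `P`, ignore the feedback
in the encoder, and decode by a threshold test on the likelihood ratio. Chernoff's bound
(`sum_not_passes_le`) and a change of measure (`outputMix_mul_sum_passes_le`) make the mean error
probability decay exponentially, while the mean distortion is exactly the single-letter one
(`sum_codebookLaw_mul_distortion`). One codebook serves both purposes because it can be chosen for
the objective "distortion plus `n` times error probability".
-/

open Filter Topology

noncomputable section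

namespace JointSensing

/-! ### Sums of products along a sequence -/

/-- The law of a sequence whose `i`-th letter is drawn from the kernel `k i`, given its strict
past. -/
def seqLaw {T : Type*} {n : ℕ} (k : (i : Fin n) → (Fin i → T) → T → ℝ) (t : Fin n → T) : ℝ :=
  ∏ i, k i (fun j => t (Fin.castLE i.isLt.le j)) (t i)

lemma seqLaw_nonneg {T : Type*} {n : ℕ} {k : (i : Fin n) → (Fin i → T) → T → ℝ}
    (hk : ∀ i p a, 0 ≤ k i p a) (t : Fin n → T) : 0 ≤ seqLaw k t :=
  Finset.prod_nonneg fun _ _ => hk _ _ _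

lemma sum_fin_succ_fun {T : Type*} [Fintype T] {n : ℕ} (F : (Fin (n + 1) → T) → ℝ) :
    ∑ t, F t = ∑ t : Fin n → T, ∑ a, F (Fin.snoc t a) := by
  rw [← (Fin.snocEquiv fun _ : Fin (n + 1) => T).sum_comp, Fintype.sum_prod_type,
    Finset.sum_comm]
  rfl

lemma snoc_past {T : Type*} {n : ℕ} (t : Fin n → T) (a : T) (i : Fin n) :
    (fun j : Fin i => (Fin.snoc t a : Fin (n + 1) → T) (Fin.castLE (by omega) j)) =
      fun j => t (Fin.castLE i.isLt.le j) := by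
  funext j
  have : (Fin.castLE (by omega) j : Fin (n + 1)) = (Fin.castLE i.isLt.le j).castSucc := rfl
  rw [this, Fin.snoc_castSucc]

lemma snoc_past_last {T : Type*} {n : ℕ} (t : Fin n → T) (a : T) :
    (fun j : Fin n => (Fin.snoc t a : Fin (n + 1) → T) (Fin.castLE (by omega) j)) = t := by
  funext j
  have : (Fin.castLE (by omega) j : Fin (n + 1)) = j.castSucc := rfl
  rw [this, Fin.snoc_castSucc]

lemma seqLaw_snoc {T : Type*} {n : ℕ} (k : (i : Fin (n + 1)) → (Fin i → T) → T → ℝ)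
    (t : Fin n → T) (a : T) :
    seqLaw k (Fin.snoc t a) =
      seqLaw (fun i : Fin n => k i.castSucc) t * k (Fin.last n) t a := by
  unfold seqLaw
  rw [Fin.prod_univ_castSucc]
  congr 1
  · refine Finset.prod_congr rfl fun i _ => ?_
    rw [Fin.snoc_castSucc]
    exact congrArg (fun p => k i.castSucc p (t i)) (snoc_past t a i)
  · rw [Fin.snoc_last]
    exact congrArg (fun p => k (Fin.last n) p a) (snoc_past_last t a)

lemma sum_seqLaw {T : Type*} [Fintype T] {n : ℕ} (k : (i : Fin n) → (Fin i → T) → T → ℝ)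
    (hk : ∀ i p, ∑ a, k i p a = 1) : ∑ t, seqLaw k t = 1 := by
  induction n with
  | zero => simp [seqLaw]
  | succ n ih =>
    simp_rw [sum_fin_succ_fun, seqLaw_snoc, ← Finset.mul_sum]
    rw [← ih (fun i => k i.castSucc) fun i p => hk _ _]
    refine Finset.sum_congr rfl fun t _ => ?_
    rw [show ∑ a, k (Fin.last n) t a = 1 from hk _ _, mul_one]

lemma sum_seqLaw_le {T : Type*} [Fintype T] {n : ℕ} (k : (i : Fin n) → (Fin i → T) → T → ℝ)
    (h0 : ∀ i p a, 0 ≤ k i p a) (hk : ∀ i p, ∑ a, k i p a ≤ 1) : ∑ t, seqLaw k t ≤ 1 := by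
  induction n with
  | zero => simp [seqLaw]
  | succ n ih =>
    simp_rw [sum_fin_succ_fun, seqLaw_snoc, ← Finset.mul_sum]
    refine le_trans ?_ (ih (fun i => k i.castSucc) (fun i p a => h0 _ _ _) fun i p => hk _ _)
    exact Finset.sum_le_sum fun t _ =>
      mul_le_of_le_one_right (seqLaw_nonneg (fun i p a => h0 _ _ _) t) (hk (Fin.last n) t)

/-- The conditional law of the `i`-th letter given its past is `k i`. -/
lemma sum_seqLaw_mul {T : Type*} [Fintype T] {n : ℕ} (k : (i : Fin n) → (Fin i → T) → T → ℝ)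
    (hk : ∀ i p, ∑ a, k i p a = 1) (i : Fin n) (G : (Fin i → T) → T → ℝ) :
    ∑ t, seqLaw k t * G (fun j => t (Fin.castLE i.isLt.le j)) (t i) =
      ∑ t, seqLaw k t * ∑ a, k i (fun j => t (Fin.castLE i.isLt.le j)) a *
        G (fun j => t (Fin.castLE i.isLt.le j)) a := by
  induction n with
  | zero => exact i.elim0
  | succ n ih =>
    rw [sum_fin_succ_fun, sum_fin_succ_fun]
    simp_rw [seqLaw_snoc]
    induction i using Fin.lastCases with
    | last =>
      refine Finset.sum_congr rfl fun t _ => ?_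
      have h : ∀ a, (fun j : Fin (Fin.last n : ℕ) =>
          (Fin.snoc t a : Fin (n + 1) → T) (Fin.castLE (Fin.last n).isLt.le j)) = t :=
        fun a => snoc_past_last t a
      simp_rw [h, Fin.snoc_last, mul_assoc, ← Finset.mul_sum]
      rw [← Finset.sum_mul, show ∑ a, k (Fin.last n) t a = 1 from hk _ _, one_mul]
    | cast i =>
      have h : ∀ (t : Fin n → T) a, (fun j : Fin (i.castSucc : ℕ) =>
          (Fin.snoc t a : Fin (n + 1) → T) (Fin.castLE i.castSucc.isLt.le j)) =
            fun j => t (Fin.castLE i.isLt.le j) := fun t a => snoc_past t a i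
      have h1 : ∀ t : Fin n → T, ∑ a, k (Fin.last n) t a = 1 := fun t => hk _ _
      have := ih (fun i => k i.castSucc) (fun i p => hk _ _) i G
      simp_rw [h, Fin.snoc_castSucc, mul_right_comm _ (k (Fin.last n) _ _),
        ← Finset.mul_sum, h1, mul_one]
      exact this

lemma sum_pi_prod {ι A : Type*} [Fintype ι] [DecidableEq ι] [Fintype A] (g : ι → A → ℝ) :
    ∑ t : ι → A, ∏ i, g i (t i) = ∏ i, ∑ a, g i a := by
  rw [Finset.prod_univ_sum, Fintype.piFinset_univ]

lemma sum_pi_prod_mul {ι A : Type*} [Fintype ι] [DecidableEq ι] [Fintype A] (g : ι → A → ℝ)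
    (i : ι) (f : A → ℝ) :
    ∑ t : ι → A, (∏ j, g j (t j)) * f (t i) =
      (∑ a, g i a * f a) * ∏ j ∈ Finset.univ.erase i, ∑ a, g j a := by
  have h : ∀ t : ι → A, (∏ j, g j (t j)) * f (t i) =
      ∏ j, Function.update g i (fun a => g i a * f a) j (t j) := by
    intro t
    rw [← Finset.mul_prod_erase _ _ (Finset.mem_univ i),
      ← Finset.mul_prod_erase _ (fun j => Function.update g i (fun a => g i a * f a) j (t j))
        (Finset.mem_univ i), Function.update_self, mul_right_comm]
    congr 1
    exact Finset.prod_congr rfl fun j hj => by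
      rw [Function.update_of_ne (Finset.ne_of_mem_erase hj)]
  simp_rw [h]
  rw [sum_pi_prod, ← Finset.mul_prod_erase _ _ (Finset.mem_univ i), Function.update_self]
  congr 1
  exact Finset.prod_congr rfl fun j hj => by
    rw [Function.update_of_ne (Finset.ne_of_mem_erase hj)]

/-- One coordinate of an i.i.d. family. -/
lemma sum_iid_apply {ι A : Type*} [Fintype ι] [DecidableEq ι] [Fintype A] {q : A → ℝ}
    (hq : ∑ a, q a = 1) (i : ι) (f : A → ℝ) :
    ∑ t : ι → A, (∏ j, q (t j)) * f (t i) = ∑ a, q a * f a := by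
  rw [sum_pi_prod_mul (fun _ => q), hq, Finset.prod_const_one, mul_one]

/-- Two distinct coordinates of an i.i.d. family are independent. -/
lemma sum_iid_apply₂ {ι A : Type*} [Fintype ι] [DecidableEq ι] [Fintype A] {q : A → ℝ}
    (hq : ∑ a, q a = 1) {i j : ι} (hij : i ≠ j) (f h : A → ℝ) :
    ∑ t : ι → A, (∏ l, q (t l)) * (f (t i) * h (t j)) =
      (∑ a, q a * f a) * ∑ a, q a * h a := by
  have hp : ∀ t : ι → A, (∏ l, q (t l)) * (f (t i) * h (t j)) =
      (∏ l, Function.update (fun _ => q) i (fun a => q a * f a) l (t l)) * h (t j) := by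
    intro t
    rw [← mul_assoc]
    congr 1
    rw [← Finset.mul_prod_erase _ _ (Finset.mem_univ i),
      ← Finset.mul_prod_erase _
        (fun l => Function.update (fun _ => q) i (fun a => q a * f a) l (t l))
        (Finset.mem_univ i), Function.update_self, mul_right_comm]
    congr 1
    exact Finset.prod_congr rfl fun l hl => by
      rw [Function.update_of_ne (Finset.ne_of_mem_erase hl)]
  simp_rw [hp]
  rw [sum_pi_prod_mul, Function.update_of_ne hij.symm,
    ← Finset.mul_prod_erase _ _ (Finset.mem_erase.2 ⟨hij, Finset.mem_univ i⟩),
    Function.update_self, Finset.prod_eq_one, mul_one, mul_comm]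
  intro l hl
  rw [Function.update_of_ne (Finset.ne_of_mem_erase hl), hq]

/-- A triple sum over sequences as a sum over sequences of triples. -/
lemma sum_sequences {n : ℕ} {S Y Z : Type*} [Fintype S] [Fintype Y] [Fintype Z]
    (F : (Fin n → S) → (Fin n → Y) → (Fin n → Z) → ℝ) :
    ∑ s, ∑ y, ∑ z, F s y z =
      ∑ t : Fin n → S × Y × Z,
        F (fun i => (t i).1) (fun i => (t i).2.1) (fun i => (t i).2.2) := by
  rw [← (Equiv.arrowProdEquivProdArrow (Fin n) (fun _ => S) (fun _ => Y × Z)).symm.sum_comp,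
    Fintype.sum_prod_type]
  refine Finset.sum_congr rfl fun s _ => ?_
  rw [← (Equiv.arrowProdEquivProdArrow (Fin n) (fun _ => Y) (fun _ => Z)).symm.sum_comp,
    Fintype.sum_prod_type]
  rfl

/-! ### Single-letter quantities -/

section SingleLetterLemmas

lemma sum_comm₄ {A B C E : Type*} [Fintype A] [Fintype B] [Fintype C] [Fintype E]
    (F : A → B → C → E → ℝ) :
    ∑ a, ∑ b, ∑ c, ∑ e, F a b c e = ∑ c, ∑ e, ∑ a, ∑ b, F a b c e := by
  calc _ = ∑ a, ∑ c, ∑ b, ∑ e, F a b c e := Finset.sum_congr rfl fun _ _ => Finset.sum_comm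
    _ = ∑ c, ∑ a, ∑ b, ∑ e, F a b c e := Finset.sum_comm
    _ = ∑ c, ∑ a, ∑ e, ∑ b, F a b c e :=
      Finset.sum_congr rfl fun _ _ => Finset.sum_congr rfl fun _ _ => Finset.sum_comm
    _ = ∑ c, ∑ e, ∑ a, ∑ b, F a b c e := Finset.sum_congr rfl fun _ _ => Finset.sum_comm

variable {X S Y Z Shat : Type*} [Fintype S] [Fintype Y] [Fintype Z]

/-- The marginal channel `P_{Y|XS}(y|x,s)`. -/
def outputLaw (ch : Channel X S Y Z) (x : X) (s : S) (y : Y) : ℝ :=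
  ∑ z, ch.trans x s (y, z)

/-- The law `P_{Y|S}(y|s)` of the output when the input has law `P`. -/
def outputMix [Fintype X] (ch : Channel X S Y Z) (P : X → ℝ) (s : S) (y : Y) : ℝ :=
  ∑ x, P x * outputLaw ch x s y

/-- `I(X;Y|S)` in nats, as an expected log-likelihood ratio. -/
def infoNats [Fintype X] (ch : Channel X S Y Z) (P : X → ℝ) : ℝ :=
  ∑ x, P x * ∑ s, ch.stateLaw s * ∑ y, outputLaw ch x s y *
    Real.log (outputLaw ch x s y / outputMix ch P s y)

/-- The expected distortion of the estimator `f` when the letter `x` is sent. -/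
def inputCost (ch : Channel X S Y Z) (d : S → Shat → ℝ) (f : X → Z → Shat) (x : X) : ℝ :=
  ∑ s, ch.stateLaw s * ∑ y, ∑ z, ch.trans x s (y, z) * d s (f x z)

lemma Channel.stateLaw_nonneg (ch : Channel X S Y Z) (s : S) : 0 ≤ ch.stateLaw s :=
  ch.stateLaw_mem.1 s

lemma Channel.sum_stateLaw (ch : Channel X S Y Z) : ∑ s, ch.stateLaw s = 1 :=
  ch.stateLaw_mem.2

lemma Channel.trans_nonneg (ch : Channel X S Y Z) (x : X) (s : S) (p : Y × Z) :
    0 ≤ ch.trans x s p :=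
  (ch.trans_mem x s).1 p

lemma Channel.sum_trans (ch : Channel X S Y Z) (x : X) (s : S) :
    ∑ y, ∑ z, ch.trans x s (y, z) = 1 := by
  rw [← Fintype.sum_prod_type]
  exact (ch.trans_mem x s).2

lemma outputLaw_nonneg (ch : Channel X S Y Z) (x : X) (s : S) (y : Y) :
    0 ≤ outputLaw ch x s y :=
  Finset.sum_nonneg fun _ _ => ch.trans_nonneg _ _ _

lemma sum_outputLaw (ch : Channel X S Y Z) (x : X) (s : S) : ∑ y, outputLaw ch x s y = 1 :=
  ch.sum_trans x s

/-- Up to the positive factor `P_{Z|X}(z|x)`, a Bayes estimator minimizes the unnormalized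
posterior distortion; where that factor vanishes, so does everything. -/
lemma IsBayesEstimator.le [Fintype X] [Fintype Shat] {ch : Channel X S Y Z}
    {d : S → Shat → ℝ} {f : X → Z → Shat} (hf : IsBayesEstimator ch d f) (x : X) (z : Z)
    (a : Shat) :
    ∑ s, ch.stateLaw s * (∑ y, ch.trans x s (y, z)) * d s (f x z) ≤
      ∑ s, ch.stateLaw s * (∑ y, ch.trans x s (y, z)) * d s a := by
  have h0 : ∀ s, 0 ≤ ch.stateLaw s * ∑ y, ch.trans x s (y, z) := fun s =>
    mul_nonneg (ch.stateLaw_nonneg s) (Finset.sum_nonneg fun _ _ => ch.trans_nonneg _ _ _)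
  rcases (Finset.sum_nonneg fun s _ => h0 s).eq_or_lt with h | h
  · have hz := (Finset.sum_eq_zero_iff_of_nonneg fun s _ => h0 s).1 h.symm
    have hz' : ∀ s, ch.stateLaw s * ∑ y, ch.trans x s (y, z) = 0 := fun s =>
      hz s (Finset.mem_univ s)
    simp only [hz', zero_mul, Finset.sum_const_zero, le_refl]
  · have := hf x z a
    simp only [posterior, div_mul_eq_mul_div, ← Finset.sum_div] at this
    exact (div_le_div_iff_of_pos_right h).1 this

lemma exists_isBayesEstimator [Fintype X] [Fintype Shat] (ch : Channel X S Y Z)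
    (d : S → Shat → ℝ) (h : X → Z → Nonempty Shat) :
    ∃ f : X → Z → Shat, IsBayesEstimator ch d f := by
  have : ∀ x z, ∃ b, ∀ a, ∑ s, posterior ch x z s * d s b ≤ ∑ s, posterior ch x z s * d s a := by
    intro x z
    have := h x z
    obtain ⟨b, hb⟩ := Finite.exists_min fun a => ∑ s, posterior ch x z s * d s a
    exact ⟨b, hb⟩
  choose f hf using this
  exact ⟨f, hf⟩

variable [Fintype X]

lemma outputMix_nonneg (ch : Channel X S Y Z) {P : X → ℝ} (hP : P ∈ stdSimplex ℝ X) (s : S)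
    (y : Y) : 0 ≤ outputMix ch P s y :=
  Finset.sum_nonneg fun x _ => mul_nonneg (hP.1 x) (outputLaw_nonneg ch x s y)

lemma sum_outputMix (ch : Channel X S Y Z) {P : X → ℝ} (hP : P ∈ stdSimplex ℝ X) (s : S) :
    ∑ y, outputMix ch P s y = 1 := by
  simp only [outputMix]
  rw [Finset.sum_comm]
  simp [← Finset.mul_sum, sum_outputLaw, hP.2]

lemma outputMix_pos (ch : Channel X S Y Z) {P : X → ℝ} (hP : P ∈ stdSimplex ℝ X) {x : X}
    {s : S} {y : Y} (hx : 0 < P x) (hW : 0 < outputLaw ch x s y) : 0 < outputMix ch P s y :=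
  Finset.sum_pos' (fun x _ => mul_nonneg (hP.1 x) (outputLaw_nonneg ch x s y))
    ⟨x, Finset.mem_univ x, mul_pos hx hW⟩

lemma mutualInfoXYgivenS_eq [Fintype Shat] (ch : Channel X S Y Z) {P : X → ℝ}
    (hP : P ∈ stdSimplex ℝ X) {Q : X → Z → Shat → ℝ} (hQ : IsEstimatorKernel Q) :
    mutualInfoXYgivenS ch P Q = infoNats ch P / Real.log 2 := by
  have hp : (fun (x : X) (y : Y) (s : S) => ∑ z, ∑ a, jointLaw ch P Q s x y z a) =
      fun x y s => P x * ch.stateLaw s * outputLaw ch x s y := by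
    funext x y s
    simp only [jointLaw, ← Finset.mul_sum, (hQ x _).2, mul_one, outputLaw]
  have h1 : ∀ s, ∑ x, ∑ y, P x * ch.stateLaw s * outputLaw ch x s y = ch.stateLaw s := by
    intro s
    simp only [← Finset.mul_sum, sum_outputLaw, mul_one, ← Finset.sum_mul, hP.2, one_mul]
  have h2 : ∀ x s, ∑ y, P x * ch.stateLaw s * outputLaw ch x s y = P x * ch.stateLaw s := by
    intro x s
    simp only [← Finset.mul_sum, sum_outputLaw, mul_one]
  have h3 : ∀ s y, ∑ x, P x * ch.stateLaw s * outputLaw ch x s y =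
      ch.stateLaw s * outputMix ch P s y := by
    intro s y
    rw [outputMix, Finset.mul_sum]
    exact Finset.sum_congr rfl fun x _ => by ring
  unfold mutualInfoXYgivenS
  rw [hp, condMutualInfo, infoNats, Finset.sum_div]
  refine Finset.sum_congr rfl fun x _ => ?_
  rw [Finset.sum_comm, Finset.mul_sum, Finset.sum_div]
  refine Finset.sum_congr rfl fun s _ => ?_
  rw [Finset.mul_sum, Finset.mul_sum, Finset.sum_div]
  refine Finset.sum_congr rfl fun y _ => ?_
  rw [h1, h2, h3]
  by_cases hx : P x = 0
  · simp [hx]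
  by_cases hs : ch.stateLaw s = 0
  · simp [hs]
  have : P x * ch.stateLaw s * outputLaw ch x s y * ch.stateLaw s /
      (P x * ch.stateLaw s * (ch.stateLaw s * outputMix ch P s y)) =
      outputLaw ch x s y / outputMix ch P s y := by
    rw [mul_assoc _ (outputLaw ch x s y), mul_div_mul_left _ _ (mul_ne_zero hx hs),
      mul_comm (outputLaw ch x s y), mul_div_mul_left _ _ hs]
  rw [this, Real.logb]
  ring

/-- `I(X;Y|S) = H(Y|S) - H(Y|X,S)`; this form is manifestly continuous in the input law. -/
lemma infoNats_eq_entropy (ch : Channel X S Y Z) {P : X → ℝ} (hP : P ∈ stdSimplex ℝ X) :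
    infoNats ch P = ∑ s, ch.stateLaw s * ∑ y, (Real.negMulLog (outputMix ch P s y) -
      ∑ x, P x * Real.negMulLog (outputLaw ch x s y)) := by
  have hterm : ∀ x s y, P x * (outputLaw ch x s y *
      Real.log (outputLaw ch x s y / outputMix ch P s y)) =
      -(P x * outputLaw ch x s y * Real.log (outputMix ch P s y)) -
        P x * Real.negMulLog (outputLaw ch x s y) := by
    intro x s y
    rcases (hP.1 x).eq_or_lt with hx | hx
    · simp [← hx]
    rcases (outputLaw_nonneg ch x s y).eq_or_lt with hW | hW
    · simp [← hW]
    rw [Real.log_div hW.ne' (outputMix_pos ch hP hx hW).ne', Real.negMulLog]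
    ring
  have h : infoNats ch P = ∑ s, ch.stateLaw s * ∑ y, ∑ x, P x * (outputLaw ch x s y *
      Real.log (outputLaw ch x s y / outputMix ch P s y)) := by
    simp only [infoNats, Finset.mul_sum]
    rw [Finset.sum_comm]
    refine Finset.sum_congr rfl fun s _ => ?_
    rw [Finset.sum_comm]
    exact Finset.sum_congr rfl fun y _ => Finset.sum_congr rfl fun x _ => by ring
  rw [h]
  simp only [hterm, Finset.sum_sub_distrib, Finset.sum_neg_distrib, ← Finset.sum_mul]
  simp only [Real.negMulLog, outputMix, neg_mul, Finset.sum_neg_distrib]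

lemma continuousOn_infoNats (ch : Channel X S Y Z) :
    ContinuousOn (infoNats ch) (stdSimplex ℝ X) := by
  refine ContinuousOn.congr (Continuous.continuousOn ?_) fun P hP => infoNats_eq_entropy ch hP
  refine continuous_finsetSum _ fun s _ => continuous_const.mul <|
    continuous_finsetSum _ fun y _ => Continuous.sub (Real.continuous_negMulLog.comp ?_) ?_
  · exact continuous_finsetSum _ fun x _ => (continuous_apply x).mul continuous_const
  · exact continuous_finsetSum _ fun x _ => (continuous_apply x).mul continuous_const

/-- No randomized estimator beats a Bayes estimator. -/
lemma IsBayesEstimator.sum_inputCost_le [Fintype Shat] {ch : Channel X S Y Z}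
    {d : S → Shat → ℝ} {f : X → Z → Shat} (hf : IsBayesEstimator ch d f) {P : X → ℝ}
    (hP : P ∈ stdSimplex ℝ X) {Q : X → Z → Shat → ℝ} (hQ : IsEstimatorKernel Q) :
    ∑ x, P x * inputCost ch d f x ≤ expectedDistortion ch d P Q := by
  have hL : ∀ x, inputCost ch d f x = ∑ z, ∑ a, Q x z a *
      ∑ s, ch.stateLaw s * (∑ y, ch.trans x s (y, z)) * d s (f x z) := by
    intro x
    simp only [← Finset.sum_mul, (hQ x _).2, one_mul, inputCost]
    rw [Finset.sum_comm]
    refine Finset.sum_congr rfl fun s _ => ?_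
    rw [Finset.sum_comm, Finset.mul_sum]
    exact Finset.sum_congr rfl fun z _ => by rw [← Finset.sum_mul]; ring
  have hR : expectedDistortion ch d P Q = ∑ x, P x * ∑ z, ∑ a, Q x z a *
      ∑ s, ch.stateLaw s * (∑ y, ch.trans x s (y, z)) * d s a := by
    simp only [expectedDistortion, jointLaw, Finset.mul_sum, Finset.sum_mul]
    rw [Finset.sum_comm]
    refine Finset.sum_congr rfl fun x _ => ?_
    rw [sum_comm₄]
    exact Finset.sum_congr rfl fun z _ => Finset.sum_congr rfl fun a _ =>
      Finset.sum_congr rfl fun s _ => Finset.sum_congr rfl fun y _ => by ring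
  rw [hR]
  refine Finset.sum_le_sum fun x _ => mul_le_mul_of_nonneg_left ?_ (hP.1 x)
  rw [hL]
  exact Finset.sum_le_sum fun z _ => Finset.sum_le_sum fun a _ =>
    mul_le_mul_of_nonneg_left (hf.le x z a) ((hQ x z).1 a)

lemma isEstimatorKernel_deterministicKernel {X Z Shat : Type*} [Fintype Shat] (f : X → Z → Shat) :
    IsEstimatorKernel (deterministicKernel f) := by
  classical
  intro x z
  refine ⟨fun a => ?_, ?_⟩
  · unfold deterministicKernel
    split_ifs <;> norm_num
  · simp [deterministicKernel]

lemma expectedDistortion_deterministicKernel [Fintype Shat] (ch : Channel X S Y Z)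
    (d : S → Shat → ℝ) (f : X → Z → Shat) (P : X → ℝ) :
    expectedDistortion ch d P (deterministicKernel f) = ∑ x, P x * inputCost ch d f x := by
  classical
  simp only [expectedDistortion, jointLaw, deterministicKernel, inputCost, Finset.mul_sum]
  rw [Finset.sum_comm]
  refine Finset.sum_congr rfl fun x _ => Finset.sum_congr rfl fun s _ =>
    Finset.sum_congr rfl fun y _ => Finset.sum_congr rfl fun z _ => ?_
  simp [mul_assoc]

end SingleLetterLemmas

/-! ### Expectations under the law of a code -/

section CodeLaw

variable {X S Y Z Shat : Type*} [Fintype S] [Fintype Y] [Fintype Z] {n M : ℕ}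

/-- The expectation of `g(W, S^n, Y^n, Z^n)` under the law of the code. -/
def Code.expect (c : Code X S Y Z Shat n M) (ch : Channel X S Y Z)
    (g : Fin M → (Fin n → S) → (Fin n → Y) → (Fin n → Z) → ℝ) : ℝ :=
  ∑ w, ∑ s, ∑ y, ∑ z, c.law ch w s y z * g w s y z

/-- The law of the letter `(S_i, Y_i, Z_i)` given the message `w` and the previous letters. -/
def Code.letterKernel (c : Code X S Y Z Shat n M) (ch : Channel X S Y Z) (w : Fin M)
    (i : Fin n) (p : Fin i → S × Y × Z) (a : S × Y × Z) : ℝ :=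
  ch.stateLaw a.1 * ch.trans (c.enc i w fun j => (p j).2.2) a.1 a.2

lemma Code.law_eq (c : Code X S Y Z Shat n M) (ch : Channel X S Y Z) (w : Fin M)
    (t : Fin n → S × Y × Z) :
    c.law ch w (fun i => (t i).1) (fun i => (t i).2.1) (fun i => (t i).2.2) =
      (M : ℝ)⁻¹ * seqLaw (c.letterKernel ch w) t := by
  simp only [Code.law, seqLaw, Code.letterKernel, Finset.prod_mul_distrib, Code.input, mul_assoc]

lemma Code.expect_eq (c : Code X S Y Z Shat n M) (ch : Channel X S Y Z)
    (g : Fin M → (Fin n → S) → (Fin n → Y) → (Fin n → Z) → ℝ) :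
    c.expect ch g = ∑ w, (M : ℝ)⁻¹ * ∑ t : Fin n → S × Y × Z, seqLaw (c.letterKernel ch w) t *
      g w (fun i => (t i).1) (fun i => (t i).2.1) (fun i => (t i).2.2) := by
  unfold Code.expect
  refine Finset.sum_congr rfl fun w _ => ?_
  rw [sum_sequences, Finset.mul_sum]
  exact Finset.sum_congr rfl fun t _ => by rw [Code.law_eq, mul_assoc]

lemma Code.law_nonneg (c : Code X S Y Z Shat n M) (ch : Channel X S Y Z) (w : Fin M)
    (s : Fin n → S) (y : Fin n → Y) (z : Fin n → Z) : 0 ≤ c.law ch w s y z :=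
  mul_nonneg (mul_nonneg (by positivity) (Finset.prod_nonneg fun _ _ => ch.stateLaw_nonneg _))
    (Finset.prod_nonneg fun _ _ => ch.trans_nonneg _ _ _)

lemma Channel.sum_letter (ch : Channel X S Y Z) (x : X) (G : S → Y → Z → ℝ) :
    ∑ a : S × Y × Z, ch.stateLaw a.1 * ch.trans x a.1 a.2 * G a.1 a.2.1 a.2.2 =
      ∑ s, ch.stateLaw s * ∑ y, ∑ z, ch.trans x s (y, z) * G s y z := by
  simp only [Fintype.sum_prod_type, Finset.mul_sum, mul_assoc]

lemma Code.sum_letterKernel (c : Code X S Y Z Shat n M) (ch : Channel X S Y Z) (w : Fin M)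
    (i : Fin n) (p : Fin i → S × Y × Z) : ∑ a, c.letterKernel ch w i p a = 1 := by
  have := ch.sum_letter (c.enc i w fun j => (p j).2.2) fun _ _ _ => 1
  simp only [mul_one, ch.sum_trans, ch.sum_stateLaw] at this
  exact this

lemma Code.expect_mono (c : Code X S Y Z Shat n M) (ch : Channel X S Y Z)
    {g h : Fin M → (Fin n → S) → (Fin n → Y) → (Fin n → Z) → ℝ}
    (hgh : ∀ w s y z, g w s y z ≤ h w s y z) : c.expect ch g ≤ c.expect ch h :=
  Finset.sum_le_sum fun w _ => Finset.sum_le_sum fun s _ => Finset.sum_le_sum fun y _ =>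
    Finset.sum_le_sum fun z _ => mul_le_mul_of_nonneg_left (hgh w s y z) (c.law_nonneg ch w s y z)

lemma Code.expect_nonneg (c : Code X S Y Z Shat n M) (ch : Channel X S Y Z)
    {g : Fin M → (Fin n → S) → (Fin n → Y) → (Fin n → Z) → ℝ}
    (hg : ∀ w s y z, 0 ≤ g w s y z) : 0 ≤ c.expect ch g :=
  Finset.sum_nonneg fun w _ => Finset.sum_nonneg fun s _ => Finset.sum_nonneg fun y _ =>
    Finset.sum_nonneg fun z _ => mul_nonneg (c.law_nonneg ch w s y z) (hg w s y z)

lemma Code.expect_const (c : Code X S Y Z Shat n M) (ch : Channel X S Y Z) (hM : M ≠ 0)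
    (r : ℝ) : c.expect ch (fun _ _ _ _ => r) = r := by
  have hM' : (M : ℝ) ≠ 0 := Nat.cast_ne_zero.2 hM
  rw [c.expect_eq]
  simp only [← Finset.sum_mul, sum_seqLaw _ (c.sum_letterKernel ch _), Finset.sum_const,
    Finset.card_univ, Fintype.card_fin, nsmul_eq_mul]
  field_simp

lemma Code.expect_sub (c : Code X S Y Z Shat n M) (ch : Channel X S Y Z)
    (g h : Fin M → (Fin n → S) → (Fin n → Y) → (Fin n → Z) → ℝ) :
    c.expect ch (fun w s y z => g w s y z - h w s y z) = c.expect ch g - c.expect ch h := by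
  simp only [Code.expect, mul_sub, Finset.sum_sub_distrib]

lemma Code.expect_mul_const (c : Code X S Y Z Shat n M) (ch : Channel X S Y Z)
    (g : Fin M → (Fin n → S) → (Fin n → Y) → (Fin n → Z) → ℝ) (r : ℝ) :
    c.expect ch (fun w s y z => g w s y z * r) = c.expect ch g * r := by
  simp only [Code.expect, ← mul_assoc, Finset.sum_mul]

lemma Code.expect_sum {ι : Type*} [Fintype ι] (c : Code X S Y Z Shat n M) (ch : Channel X S Y Z)
    (g : ι → Fin M → (Fin n → S) → (Fin n → Y) → (Fin n → Z) → ℝ) :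
    c.expect ch (fun w s y z => ∑ i, g i w s y z) = ∑ i, c.expect ch (g i) := by
  simp only [Code.expect, Finset.mul_sum]
  symm
  rw [Finset.sum_comm]
  refine Finset.sum_congr rfl fun w _ => ?_
  rw [Finset.sum_comm]
  refine Finset.sum_congr rfl fun s _ => ?_
  rw [Finset.sum_comm]
  refine Finset.sum_congr rfl fun y _ => ?_
  rw [Finset.sum_comm]

/-- Given the past, the letter `(S_i, Y_i, Z_i)` is produced by the channel from the current
input. -/
lemma Code.expect_letter (c : Code X S Y Z Shat n M) (ch : Channel X S Y Z) (i : Fin n)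
    (G : X → S → Y → Z → ℝ) :
    c.expect ch (fun w s y z => G (c.input w z i) (s i) (y i) (z i)) =
      c.expect ch (fun w _ _ z => ∑ s, ch.stateLaw s * ∑ y', ∑ z',
        ch.trans (c.input w z i) s (y', z') * G (c.input w z i) s y' z') := by
  rw [c.expect_eq, c.expect_eq]
  refine Finset.sum_congr rfl fun w _ => ?_
  congr 1
  have := sum_seqLaw_mul (c.letterKernel ch w) (c.sum_letterKernel ch w) i
    fun p a => G (c.enc i w fun j => (p j).2.2) a.1 a.2.1 a.2.2
  refine this.trans (Finset.sum_congr rfl fun t _ => ?_)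
  congr 1
  exact ch.sum_letter _ fun s y z => G _ s y z

open Classical in
/-- The input law of the code, averaged over the block. -/
def Code.avgInput (c : Code X S Y Z Shat n M) (ch : Channel X S Y Z) (x : X) : ℝ :=
  (n : ℝ)⁻¹ * ∑ i, c.expect ch fun w _ _ z => if c.input w z i = x then 1 else 0

lemma Code.avgInput_pos (c : Code X S Y Z Shat n M) (ch : Channel X S Y Z) {w : Fin M}
    {s : Fin n → S} {y : Fin n → Y} {z : Fin n → Z} (h : 0 < c.law ch w s y z) (i : Fin n) :
    0 < c.avgInput ch (c.input w z i) := by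
  classical
  have hn : 0 < (n : ℝ) := Nat.cast_pos.2 i.pos
  have h0 : ∀ (i : Fin n) (x : X) w s y z,
      0 ≤ c.law ch w s y z * if c.input w z i = x then 1 else 0 := fun i x w s y z =>
    mul_nonneg (c.law_nonneg ch w s y z) (by split_ifs <;> norm_num)
  refine mul_pos (inv_pos.2 hn) (Finset.sum_pos' (fun j _ => ?_) ⟨i, Finset.mem_univ i, ?_⟩)
  · exact Finset.sum_nonneg fun w _ => Finset.sum_nonneg fun s _ => Finset.sum_nonneg fun y _ =>
      Finset.sum_nonneg fun z _ => h0 _ _ w s y z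
  · refine Finset.sum_pos' (fun w _ => Finset.sum_nonneg fun s _ => Finset.sum_nonneg fun y _ =>
      Finset.sum_nonneg fun z _ => h0 _ _ w s y z) ⟨w, Finset.mem_univ w, ?_⟩
    refine Finset.sum_pos' (fun s _ => Finset.sum_nonneg fun y _ =>
      Finset.sum_nonneg fun z _ => h0 _ _ w s y z) ⟨s, Finset.mem_univ s, ?_⟩
    refine Finset.sum_pos' (fun y _ =>
      Finset.sum_nonneg fun z _ => h0 _ _ w s y z) ⟨y, Finset.mem_univ y, ?_⟩
    refine Finset.sum_pos' (fun z _ => h0 _ _ w s y z) ⟨z, Finset.mem_univ z, ?_⟩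
    simpa using h

lemma Code.errorProb_eq (c : Code X S Y Z Shat n M) (ch : Channel X S Y Z) :
    c.errorProb ch = c.expect ch fun w s y _ => if c.dec y s ≠ w then 1 else 0 := by
  simp only [Code.errorProb, Code.expect, mul_ite, mul_one, mul_zero]

lemma Code.distortion_eq (c : Code X S Y Z Shat n M) (ch : Channel X S Y Z)
    (d : S → Shat → ℝ) :
    c.distortion ch d =
      (n : ℝ)⁻¹ * ∑ i, c.expect ch fun w s _ z => d (s i) (c.est (c.input w z) z i) := rfl

variable [Fintype X]

lemma Code.sum_avgInput_mul (c : Code X S Y Z Shat n M) (ch : Channel X S Y Z) (H : X → ℝ) :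
    ∑ x, c.avgInput ch x * H x =
      (n : ℝ)⁻¹ * ∑ i, c.expect ch fun w _ _ z => H (c.input w z i) := by
  classical
  simp only [Code.avgInput, mul_assoc, ← Finset.mul_sum, Finset.sum_mul]
  rw [Finset.sum_comm]
  congr 1
  refine Finset.sum_congr rfl fun i _ => ?_
  simp only [← Code.expect_mul_const]
  rw [← Code.expect_sum]
  simp

lemma Code.avgInput_mem (c : Code X S Y Z Shat n M) (ch : Channel X S Y Z) (hM : M ≠ 0)
    (hn : n ≠ 0) : c.avgInput ch ∈ stdSimplex ℝ X := by
  classical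
  have hn' : (n : ℝ) ≠ 0 := Nat.cast_ne_zero.2 hn
  refine ⟨fun x => mul_nonneg (by positivity) (Finset.sum_nonneg fun i _ => ?_), ?_⟩
  · exact c.expect_nonneg ch fun w s y z => by split_ifs <;> norm_num
  · have := c.sum_avgInput_mul ch fun _ => 1
    simpa [c.expect_const ch hM, hn'] using this

/-- Block averages of single-letter expectations only depend on the averaged input law. -/
lemma Code.sum_expect_letter (c : Code X S Y Z Shat n M) (ch : Channel X S Y Z)
    (G : X → S → Y → Z → ℝ) :
    (n : ℝ)⁻¹ * ∑ i, c.expect ch (fun w s y z => G (c.input w z i) (s i) (y i) (z i)) =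
      ∑ x, c.avgInput ch x * ∑ s, ch.stateLaw s * ∑ y, ∑ z, ch.trans x s (y, z) * G x s y z := by
  simp only [Code.expect_letter, Code.sum_avgInput_mul]

end CodeLaw

/-! ### Converse -/

section Converse

variable {X S Y Z Shat : Type*} [Fintype S] [Fintype Y] [Fintype Z] {n M : ℕ}

lemma trans_le_outputLaw (ch : Channel X S Y Z) (x : X) (s : S) (y : Y) (z : Z) :
    ch.trans x s (y, z) ≤ outputLaw ch x s y :=
  Finset.single_le_sum (f := fun z => ch.trans x s (y, z)) (fun _ _ => ch.trans_nonneg _ _ _)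
    (Finset.mem_univ z)

/-- The symbolwise Bayes estimator beats any estimator that sees the whole block: given the message
and `z^n`, the states are independent and `S_i` has the posterior law given `x_i` and `z_i`. -/
lemma Code.expect_bayes_le [Fintype X] [Fintype Shat] (c : Code X S Y Z Shat n M)
    (ch : Channel X S Y Z) {d : S → Shat → ℝ} {f : X → Z → Shat} (hf : IsBayesEstimator ch d f)
    (i : Fin n) :
    c.expect ch (fun w s _ z => d (s i) (f (c.input w z i) (z i))) ≤
      c.expect ch (fun w s _ z => d (s i) (c.est (c.input w z) z i)) := by
  classical
  have key : ∀ (w : Fin M) (z : Fin n → Z) (a : Shat),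
      ∑ s, ∑ y, c.law ch w s y z * d (s i) a =
        (M : ℝ)⁻¹ * ((∑ s, ch.stateLaw s * (∑ y, ch.trans (c.input w z i) s (y, z i)) * d s a) *
          ∏ j ∈ Finset.univ.erase i,
            ∑ s, ch.stateLaw s * ∑ y, ch.trans (c.input w z j) s (y, z j)) := by
    intro w z a
    rw [← sum_pi_prod_mul (fun j s => ch.stateLaw s * ∑ y, ch.trans (c.input w z j) s (y, z j)) i
      (fun s => d s a), Finset.mul_sum]
    refine Finset.sum_congr rfl fun s _ => ?_
    rw [Finset.prod_mul_distrib, ← sum_pi_prod fun j y => ch.trans (c.input w z j) (s j) (y, z j),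
      ← Finset.sum_mul]
    simp only [Code.law, ← Finset.mul_sum, mul_assoc]
  have swap : ∀ g : Fin M → (Fin n → S) → (Fin n → Z) → ℝ,
      c.expect ch (fun w s _ z => g w s z) =
        ∑ w, ∑ z, ∑ s, ∑ y, c.law ch w s y z * g w s z := by
    intro g
    refine Finset.sum_congr rfl fun w _ => ?_
    rw [Finset.sum_comm]
    simp only [Finset.sum_comm (s := (Finset.univ : Finset (Fin n → S)))
      (t := (Finset.univ : Finset (Fin n → Z)))]
    rw [Finset.sum_comm]
    exact Finset.sum_congr rfl fun z _ => Finset.sum_comm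
  rw [swap fun w s z => d (s i) (f (c.input w z i) (z i)),
    swap fun w s z => d (s i) (c.est (c.input w z) z i)]
  refine Finset.sum_le_sum fun w _ => Finset.sum_le_sum fun z _ => ?_
  rw [key, key]
  refine mul_le_mul_of_nonneg_left (mul_le_mul_of_nonneg_right (hf.le _ _ _) ?_) (by positivity)
  exact Finset.prod_nonneg fun j _ => Finset.sum_nonneg fun s _ =>
    mul_nonneg (ch.stateLaw_nonneg s) (Finset.sum_nonneg fun _ _ => ch.trans_nonneg _ _ _)

lemma Code.sum_avgInput_inputCost_le [Fintype X] [Fintype Shat] (c : Code X S Y Z Shat n M)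
    (ch : Channel X S Y Z) {d : S → Shat → ℝ} {f : X → Z → Shat}
    (hf : IsBayesEstimator ch d f) :
    ∑ x, c.avgInput ch x * inputCost ch d f x ≤ c.distortion ch d := by
  have := c.sum_expect_letter ch fun x s _ z => d s (f x z)
  rw [c.distortion_eq]
  refine this.symm.le.trans ?_
  exact mul_le_mul_of_nonneg_left (Finset.sum_le_sum fun i _ => c.expect_bayes_le ch hf i)
    (by positivity)

/-- The comparison law of the converse: message and states as before, `Y_i` drawn from `q(·|s_i)`
whatever is sent, and `Z_i` from `P_{Z|XSY}`. With this `Z` summed out, the message is independent of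
the decoder's observation. Letters with `P_{Y|XS} = 0` get mass `0` through division by zero, so the
total mass may be below `1`, and the independence turns into an inequality. -/
def Code.refLaw (c : Code X S Y Z Shat n M) (ch : Channel X S Y Z) (q : S → Y → ℝ)
    (w : Fin M) (s : Fin n → S) (y : Fin n → Y) (z : Fin n → Z) : ℝ :=
  (M : ℝ)⁻¹ * (∏ i, ch.stateLaw (s i)) * ((∏ i, q (s i) (y i)) *
    ∏ i, ch.trans (c.input w z i) (s i) (y i, z i) / outputLaw ch (c.input w z i) (s i) (y i))

lemma Code.refLaw_nonneg (c : Code X S Y Z Shat n M) (ch : Channel X S Y Z) {q : S → Y → ℝ}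
    (hq : ∀ s y, 0 ≤ q s y) (w : Fin M) (s : Fin n → S) (y : Fin n → Y) (z : Fin n → Z) :
    0 ≤ c.refLaw ch q w s y z :=
  mul_nonneg (mul_nonneg (by positivity) (Finset.prod_nonneg fun _ _ => ch.stateLaw_nonneg _))
    (mul_nonneg (Finset.prod_nonneg fun _ _ => hq _ _)
      (Finset.prod_nonneg fun _ _ => div_nonneg (ch.trans_nonneg _ _ _) (outputLaw_nonneg ch _ _ _)))

/-- Summing out the feedback letter by letter, from the last to the first. -/
lemma Code.sum_refLaw_le (c : Code X S Y Z Shat n M) (ch : Channel X S Y Z) {q : S → Y → ℝ}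
    (hq : ∀ s y, 0 ≤ q s y) (w : Fin M) (s : Fin n → S) (y : Fin n → Y) :
    ∑ z, c.refLaw ch q w s y z ≤
      (M : ℝ)⁻¹ * (∏ i, ch.stateLaw (s i)) * ∏ i, q (s i) (y i) := by
  simp only [Code.refLaw, ← Finset.mul_sum]
  refine mul_le_mul_of_nonneg_left ?_
    (mul_nonneg (by positivity) (Finset.prod_nonneg fun _ _ => ch.stateLaw_nonneg _))
  refine mul_le_of_le_one_right (Finset.prod_nonneg fun _ _ => hq _ _) ?_
  refine sum_seqLaw_le (fun i p a => ch.trans (c.enc i w p) (s i) (y i, a) /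
    outputLaw ch (c.enc i w p) (s i) (y i))
    (fun i p a => div_nonneg (ch.trans_nonneg _ _ _) (outputLaw_nonneg ch _ _ _)) fun i p => ?_
  rw [← Finset.sum_div]
  exact div_self_le_one _

/-- With likelihood bonus `M` for a correct guess, the comparison law has mass at most `2`, since
under it a guess is correct with probability at most `1 / M`. -/
lemma Code.sum_refLaw_bonus_le (c : Code X S Y Z Shat n M) (ch : Channel X S Y Z)
    {q : S → Y → ℝ} (hq : ∀ s y, 0 ≤ q s y) (hq1 : ∀ s, ∑ y, q s y = 1) (hM : M ≠ 0) :
    ∑ w, ∑ s, ∑ y, ∑ z, c.refLaw ch q w s y z * (if c.dec y s = w then (M : ℝ) else 1) ≤ 2 := by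
  classical
  have hM' : (M : ℝ) ≠ 0 := Nat.cast_ne_zero.2 hM
  have h1 : ∀ w s y, ∑ z, c.refLaw ch q w s y z * (if c.dec y s = w then (M : ℝ) else 1) ≤
      ((∏ i, ch.stateLaw (s i)) * ∏ i, q (s i) (y i)) *
        ((if c.dec y s = w then 1 else 0) + (M : ℝ)⁻¹) := by
    intro w s y
    rw [← Finset.sum_mul]
    have hA : 0 ≤ (∏ i, ch.stateLaw (s i)) * ∏ i, q (s i) (y i) :=
      mul_nonneg (Finset.prod_nonneg fun _ _ => ch.stateLaw_nonneg _)
        (Finset.prod_nonneg fun _ _ => hq _ _)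
    have hr := c.sum_refLaw_le ch hq w s y
    rw [mul_assoc] at hr
    refine (mul_le_mul_of_nonneg_right hr (by split_ifs <;> positivity)).trans ?_
    rw [mul_comm (M : ℝ)⁻¹, mul_assoc]
    refine mul_le_mul_of_nonneg_left ?_ hA
    split_ifs
    · rw [inv_mul_cancel₀ hM']
      simp
    · simp
  calc _ ≤ ∑ w : Fin M, ∑ s, ∑ y, ((∏ i, ch.stateLaw (s i)) * ∏ i, q (s i) (y i)) *
        ((if c.dec y s = w then 1 else 0) + (M : ℝ)⁻¹) :=
      Finset.sum_le_sum fun w _ => Finset.sum_le_sum fun s _ => Finset.sum_le_sum fun y _ => h1 w s y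
    _ = ∑ s : Fin n → S, ∑ y : Fin n → Y,
        ((∏ i, ch.stateLaw (s i)) * ∏ i, q (s i) (y i)) * 2 := by
      rw [Finset.sum_comm]
      refine Finset.sum_congr rfl fun s _ => ?_
      rw [Finset.sum_comm]
      refine Finset.sum_congr rfl fun y _ => ?_
      rw [← Finset.mul_sum, Finset.sum_add_distrib]
      simp [hM']
      norm_num
    _ = 2 := by
      have hy : ∀ s : Fin n → S, ∑ y : Fin n → Y, ∏ i, q (s i) (y i) = 1 := fun s => by
        rw [sum_pi_prod fun i => q (s i)]
        simp [hq1]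
      simp only [← Finset.sum_mul, ← Finset.mul_sum, hy, mul_one]
      rw [sum_pi_prod fun _ => ch.stateLaw]
      simp [ch.sum_stateLaw]

/-- Fano's inequality and the single-letter bound in one step: compare the law of the code with
`Code.refLaw`, where `q` is the output law of the averaged input, through `1 - u ≤ exp (-u)`. -/
theorem Code.fano [Fintype X] (c : Code X S Y Z Shat n M) (ch : Channel X S Y Z) (hM : M ≠ 0)
    (hn : n ≠ 0) :
    (1 - c.errorProb ch) * Real.log M - 1 ≤ n * infoNats ch (c.avgInput ch) := by
  classical
  have hn' : (n : ℝ) ≠ 0 := Nat.cast_ne_zero.2 hn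
  have hMpos : (0 : ℝ) < M := Nat.cast_pos.2 (Nat.pos_of_ne_zero hM)
  set P := c.avgInput ch with hPdef
  have hP : P ∈ stdSimplex ℝ X := c.avgInput_mem ch hM hn
  set q := outputMix ch P with hqdef
  have hq : ∀ s y, 0 ≤ q s y := outputMix_nonneg ch hP
  let L : Fin M → (Fin n → S) → (Fin n → Y) → (Fin n → Z) → ℝ := fun w s y z =>
    ∑ i, Real.log (outputLaw ch (c.input w z i) (s i) (y i) / q (s i) (y i))
  let g : Fin M → (Fin n → S) → (Fin n → Y) → (Fin n → Z) → ℝ := fun w s y _ =>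
    (1 - if c.dec y s ≠ w then 1 else 0) * Real.log M
  have hg : ∀ w s y z, Real.exp (g w s y z) = if c.dec y s = w then (M : ℝ) else 1 := by
    intro w s y z
    by_cases h : c.dec y s = w
    · simp [g, h, Real.exp_log hMpos]
    · simp [g, h]
  -- where the law is positive so are all its factors, and `refLaw = law * exp (-L)`
  have hpt : ∀ w s y z, c.law ch w s y z * 1 - c.refLaw ch q w s y z *
      (if c.dec y s = w then (M : ℝ) else 1) ≤ c.law ch w s y z * (L w s y z - g w s y z) := by
    intro w s y z
    rcases (c.law_nonneg ch w s y z).eq_or_lt with h | h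
    · rw [← h, ← hg w s y z, zero_mul, zero_mul, zero_sub, neg_nonpos]
      exact mul_nonneg (c.refLaw_nonneg ch hq w s y z) (Real.exp_pos _).le
    · have hne : c.law ch w s y z ≠ 0 := h.ne'
      unfold Code.law at hne
      have htr : ∀ i, 0 < ch.trans (c.input w z i) (s i) (y i, z i) := fun i =>
        (ch.trans_nonneg _ _ _).lt_of_ne'
          (Finset.prod_ne_zero_iff.1 (right_ne_zero_of_mul hne) i (Finset.mem_univ i))
      have hW : ∀ i, 0 < outputLaw ch (c.input w z i) (s i) (y i) := fun i =>
        (htr i).trans_le (trans_le_outputLaw ch _ _ _ _)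
      have hqp : ∀ i, 0 < q (s i) (y i) := fun i =>
        outputMix_pos ch hP (c.avgInput_pos ch h i) (hW i)
      have href : c.refLaw ch q w s y z = c.law ch w s y z * Real.exp (-L w s y z) := by
        simp only [L, Code.refLaw, Code.law]
        rw [← Finset.sum_neg_distrib, Real.exp_sum, mul_assoc _ (∏ i, ch.trans _ _ _),
          ← Finset.prod_mul_distrib, ← Finset.prod_mul_distrib]
        congr 1
        refine Finset.prod_congr rfl fun i _ => ?_
        rw [Real.exp_neg, Real.exp_log (div_pos (hW i) (hqp i)), inv_div]
        ring
      rw [href, ← hg w s y z, mul_assoc, ← Real.exp_add, ← mul_sub]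
      refine mul_le_mul_of_nonneg_left ?_ h.le
      rw [show -L w s y z + g w s y z = -(L w s y z - g w s y z) by ring]
      linarith [Real.one_sub_le_exp_neg (L w s y z - g w s y z)]
  have hsum : c.expect ch (fun _ _ _ _ => 1) - ∑ w, ∑ s, ∑ y, ∑ z, c.refLaw ch q w s y z *
      (if c.dec y s = w then (M : ℝ) else 1) ≤ c.expect ch fun w s y z => L w s y z - g w s y z := by
    simp only [Code.expect, ← Finset.sum_sub_distrib]
    exact Finset.sum_le_sum fun w _ => Finset.sum_le_sum fun s _ => Finset.sum_le_sum fun y _ =>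
      Finset.sum_le_sum fun z _ => hpt w s y z
  have hL : c.expect ch L = n * infoNats ch P := by
    have := c.sum_expect_letter ch fun x s y _ => Real.log (outputLaw ch x s y / q s y)
    rw [← Code.expect_sum] at this
    rw [inv_mul_eq_iff_eq_mul₀ hn'] at this
    refine this.trans ?_
    simp only [infoNats, ← Finset.sum_mul, outputLaw, ← hPdef, ← hqdef]
  have hgE : c.expect ch g = (1 - c.errorProb ch) * Real.log M := by
    simp only [g]
    rw [c.expect_mul_const ch (fun w s y _ => 1 - if c.dec y s ≠ w then 1 else 0),
      c.expect_sub ch (fun _ _ _ _ => 1) fun w s y _ => if c.dec y s ≠ w then 1 else 0,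
      c.expect_const ch hM, c.errorProb_eq]
  rw [c.expect_sub, hL, hgE, c.expect_const ch hM] at hsum
  have := c.sum_refLaw_bonus_le ch hq (sum_outputMix ch hP) hM
  linarith

lemma Code.errorProb_nonneg (c : Code X S Y Z Shat n M) (ch : Channel X S Y Z) :
    0 ≤ c.errorProb ch := by
  rw [c.errorProb_eq]
  exact c.expect_nonneg ch fun w s y z => by split_ifs <;> norm_num

lemma Code.errorProb_le_one (c : Code X S Y Z Shat n M) (ch : Channel X S Y Z) (hM : M ≠ 0) :
    c.errorProb ch ≤ 1 := by
  rw [c.errorProb_eq]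
  refine (c.expect_mono ch (h := fun _ _ _ _ => 1) fun w s y z => ?_).trans_eq
    (c.expect_const ch hM 1)
  split_ifs <;> norm_num

lemma Code.distortion_nonneg (c : Code X S Y Z Shat n M) (ch : Channel X S Y Z)
    {d : S → Shat → ℝ} (hd : ∀ s a, 0 ≤ d s a) : 0 ≤ c.distortion ch d := by
  rw [c.distortion_eq]
  exact mul_nonneg (by positivity)
    (Finset.sum_nonneg fun i _ => c.expect_nonneg ch fun w s y z => hd _ _)

lemma Code.distortion_le [Fintype Shat] (c : Code X S Y Z Shat n M) (ch : Channel X S Y Z)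
    (hM : M ≠ 0) {d : S → Shat → ℝ} (hd : ∀ s a, 0 ≤ d s a) :
    c.distortion ch d ≤ ∑ s, ∑ a, d s a := by
  have hB : 0 ≤ ∑ s, ∑ a, d s a := Finset.sum_nonneg fun s _ => Finset.sum_nonneg fun a _ => hd s a
  have hle : ∀ s a, d s a ≤ ∑ s, ∑ a, d s a := fun s a =>
    (Finset.single_le_sum (fun a _ => hd s a) (Finset.mem_univ a)).trans
      (Finset.single_le_sum (f := fun s => ∑ a, d s a)
        (fun s _ => Finset.sum_nonneg fun a _ => hd s a) (Finset.mem_univ s))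
  rw [c.distortion_eq]
  calc _ ≤ (n : ℝ)⁻¹ * ∑ _i : Fin n, ∑ s, ∑ a, d s a := by
        refine mul_le_mul_of_nonneg_left (Finset.sum_le_sum fun i _ => ?_) (by positivity)
        exact (c.expect_mono ch fun w s y z => hle _ _).trans_eq (c.expect_const ch hM _)
    _ ≤ _ := by
        rw [Finset.sum_const, Finset.card_univ, Fintype.card_fin, nsmul_eq_mul, ← mul_assoc]
        exact mul_le_of_le_one_left hB (inv_mul_le_one)

lemma one_le_messageCount {R : ℝ} (hR : 0 ≤ R) (n : ℕ) : 1 ≤ ⌊(2 : ℝ) ^ ((n : ℝ) * R)⌋₊ :=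
  Nat.le_floor (by
    rw [Nat.cast_one]
    exact Real.one_le_rpow (by norm_num) (by positivity))

/-- Rounding `2 ^ (n R)` down costs at most one bit. -/
lemma le_log_messageCount {R : ℝ} (hR : 0 ≤ R) (n : ℕ) :
    (n * R - 1) * Real.log 2 ≤ Real.log (⌊(2 : ℝ) ^ ((n : ℝ) * R)⌋₊ : ℝ) := by
  have h1 : (1 : ℝ) ≤ (⌊(2 : ℝ) ^ ((n : ℝ) * R)⌋₊ : ℝ) := by
    exact_mod_cast one_le_messageCount hR n
  have h2 := Nat.lt_floor_add_one ((2 : ℝ) ^ ((n : ℝ) * R))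
  rw [← Real.log_rpow (by norm_num)]
  refine Real.log_le_log (by positivity) ?_
  rw [Real.rpow_sub (by norm_num), Real.rpow_one]
  linarith

/-- An achievable rate is at most the mutual information of some input law that meets the distortion
constraint: a limit point of the averaged input laws of the codes. -/
theorem Achievable.exists_inputLaw [Fintype X] [Fintype Shat] {ch : Channel X S Y Z}
    {d : S → Shat → ℝ} (hd : ∀ s a, 0 ≤ d s a) {R D : ℝ} (h : Achievable ch d R D)
    {f : X → Z → Shat} (hf : IsBayesEstimator ch d f) :
    ∃ P ∈ stdSimplex ℝ X, ∑ x, P x * inputCost ch d f x ≤ D ∧ R ≤ infoNats ch P / Real.log 2 := by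
  obtain ⟨hR, c, herr, hdist⟩ := h
  have hlog2 : 0 < Real.log 2 := Real.log_pos (by norm_num)
  have hM : ∀ n : ℕ, ⌊(2 : ℝ) ^ ((n : ℝ) * R)⌋₊ ≠ 0 := fun n =>
    (Nat.lt_of_lt_of_le Nat.zero_lt_one (one_le_messageCount hR n)).ne'
  obtain ⟨P, hP, φ, hφ, hlim⟩ := (isCompact_stdSimplex ℝ X).tendsto_subseq
    (x := fun n => (c (n + 1)).avgInput ch) fun n => (c (n + 1)).avgInput_mem ch (hM _) (by omega)
  have hφ1 : Tendsto (fun k => φ k + 1) atTop atTop :=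
    (tendsto_add_atTop_nat 1).comp hφ.tendsto_atTop
  refine ⟨P, hP, ?_, ?_⟩
  · have hcost : Tendsto (fun k => ∑ x, (c (φ k + 1)).avgInput ch x * inputCost ch d f x) atTop
        (𝓝 (∑ x, P x * inputCost ch d f x)) :=
      tendsto_finsetSum _ fun x _ => (tendsto_pi_nhds.1 hlim x).mul_const _
    refine le_of_forall_pos_le_add fun ε hε => ?_
    have hev := eventually_lt_of_limsup_lt (lt_of_le_of_lt hdist (lt_add_of_pos_right D hε))
      (isBoundedUnder_of ⟨_, fun n => (c n).distortion_le ch (hM n) hd⟩)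
    refine le_of_tendsto hcost ((hφ1.eventually hev).mono fun k hk => ?_)
    exact ((c (φ k + 1)).sum_avgInput_inputCost_le ch hf).trans hk.le
  · have hinfo : Tendsto (fun k => infoNats ch ((c (φ k + 1)).avgInput ch)) atTop
        (𝓝 (infoNats ch P)) :=
      (continuousOn_infoNats ch P hP).tendsto.comp (tendsto_nhdsWithin_iff.2
        ⟨hlim, Eventually.of_forall fun k => (c (φ k + 1)).avgInput_mem ch (hM _) (by omega)⟩)
    have hinv : Tendsto (fun k => ((φ k + 1 : ℕ) : ℝ)⁻¹) atTop (𝓝 0) :=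
      tendsto_inv_atTop_nhds_zero_nat.comp hφ1
    have hleft : Tendsto (fun k => (1 - (c (φ k + 1)).errorProb ch) *
        ((R - ((φ k + 1 : ℕ) : ℝ)⁻¹) * Real.log 2) - ((φ k + 1 : ℕ) : ℝ)⁻¹) atTop
        (𝓝 ((1 - 0) * ((R - 0) * Real.log 2) - 0)) :=
      (((herr.comp hφ1).const_sub 1).mul ((hinv.const_sub R).mul_const _)).sub hinv
    have := le_of_tendsto_of_tendsto' hleft hinfo fun k => ?_
    · rw [le_div_iff₀ hlog2]
      linarith
    · have hpos : (0 : ℝ) < ((φ k + 1 : ℕ) : ℝ) := by positivity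
      have hfano := (c (φ k + 1)).fano ch (hM _) (by omega)
      have hmul := mul_le_mul_of_nonneg_left (le_log_messageCount hR (φ k + 1))
        (sub_nonneg.2 ((c (φ k + 1)).errorProb_le_one ch (hM _)))
      refine le_of_mul_le_mul_left ?_ hpos
      refine le_trans (le_of_eq ?_) ((sub_le_sub_right hmul 1).trans hfano)
      field_simp

end Converse

/-! ### Random coding -/

section RandomCoding

variable {X S Y Z Shat : Type*} [Fintype X] [Fintype S] [Fintype Y] [Fintype Z] {n M : ℕ}

/-- The threshold test of the decoder: the likelihood of the word `x` exceeds that of the output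
mixture by a factor `exp (n γ)`. -/
def Passes (ch : Channel X S Y Z) (P : X → ℝ) (γ : ℝ) (x : Fin n → X) (s : Fin n → S)
    (y : Fin n → Y) : Prop :=
  Real.exp (n * γ) * ∏ i, outputMix ch P (s i) (y i) < ∏ i, outputLaw ch (x i) (s i) (y i)

open Classical in
/-- The code with codebook `C` that ignores the feedback when encoding, decodes to some message whose
codeword passes the threshold test (to the first message if there is none) and estimates the states
letter by letter with `f`. -/
def codebookCode (ch : Channel X S Y Z) (f : X → Z → Shat) (P : X → ℝ) (γ : ℝ) (hM : 0 < M)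
    (C : Fin M → Fin n → X) : Code X S Y Z Shat n M where
  enc i w _ := C w i
  dec y s := if h : ∃ w, Passes ch P γ (C w) s y then h.choose else ⟨0, hM⟩
  est x z i := f (x i) (z i)

/-- The law of a random codebook with i.i.d. letters. -/
def codebookLaw (P : X → ℝ) (C : Fin M → Fin n → X) : ℝ :=
  ∏ w, ∏ i, P (C w i)

lemma sum_prod_eq_one {P : X → ℝ} (hP : P ∈ stdSimplex ℝ X) :
    ∑ x : Fin n → X, ∏ i, P (x i) = 1 := by
  classical
  rw [sum_pi_prod fun _ => P]
  simp [hP.2]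

lemma codebookLaw_nonneg {P : X → ℝ} (hP : P ∈ stdSimplex ℝ X) (C : Fin M → Fin n → X) :
    0 ≤ codebookLaw P C :=
  Finset.prod_nonneg fun _ _ => Finset.prod_nonneg fun _ _ => hP.1 _

lemma sum_codebookLaw {P : X → ℝ} (hP : P ∈ stdSimplex ℝ X) :
    ∑ C : Fin M → Fin n → X, codebookLaw P C = 1 := by
  classical
  unfold codebookLaw
  rw [sum_pi_prod fun _ (x : Fin n → X) => ∏ i, P (x i)]
  simp [sum_prod_eq_one hP]

omit [Fintype X] in
lemma Code.expect_message (c : Code X S Y Z Shat n M) (ch : Channel X S Y Z) (g : Fin M → ℝ) :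
    c.expect ch (fun w _ _ _ => g w) = (M : ℝ)⁻¹ * ∑ w, g w := by
  rw [c.expect_eq, Finset.mul_sum]
  refine Finset.sum_congr rfl fun w _ => ?_
  rw [← Finset.sum_mul, sum_seqLaw _ (c.sum_letterKernel ch _), one_mul]

/-- The expected distortion of a random codebook is exactly the single-letter one. -/
lemma sum_codebookLaw_mul_distortion (ch : Channel X S Y Z) (d : S → Shat → ℝ)
    (f : X → Z → Shat) {P : X → ℝ} (hP : P ∈ stdSimplex ℝ X) (γ : ℝ) (hM : 0 < M) :
    ∑ C : Fin M → Fin n → X, codebookLaw P C * (codebookCode ch f P γ hM C).distortion ch d =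
      (n : ℝ)⁻¹ * n * ∑ x, P x * inputCost ch d f x := by
  classical
  have hM' : (M : ℝ) ≠ 0 := Nat.cast_ne_zero.2 hM.ne'
  have h1 : ∀ C : Fin M → Fin n → X, (codebookCode ch f P γ hM C).distortion ch d =
      (n : ℝ)⁻¹ * ∑ i, (M : ℝ)⁻¹ * ∑ w, inputCost ch d f (C w i) := by
    intro C
    rw [Code.distortion_eq]
    congr 1
    refine Finset.sum_congr rfl fun i _ => ?_
    rw [← (codebookCode ch f P γ hM C).expect_message ch fun w => inputCost ch d f (C w i)]
    exact (codebookCode ch f P γ hM C).expect_letter ch i fun x s _ z => d s (f x z)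
  have h2 : ∀ (w : Fin M) (i : Fin n), ∑ C : Fin M → Fin n → X,
      codebookLaw P C * inputCost ch d f (C w i) = ∑ x, P x * inputCost ch d f x := by
    intro w i
    unfold codebookLaw
    rw [sum_iid_apply (q := fun x : Fin n → X => ∏ i, P (x i)) (sum_prod_eq_one hP) w
      fun x => inputCost ch d f (x i)]
    exact sum_iid_apply hP.2 i _
  calc _ = (n : ℝ)⁻¹ * ∑ i : Fin n, (M : ℝ)⁻¹ * ∑ w, ∑ C : Fin M → Fin n → X,
        codebookLaw P C * inputCost ch d f (C w i) := by
        simp only [h1, Finset.mul_sum]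
        rw [Finset.sum_comm]
        refine Finset.sum_congr rfl fun i _ => ?_
        rw [Finset.sum_comm]
        exact Finset.sum_congr rfl fun w _ => Finset.sum_congr rfl fun C _ => by ring
    _ = _ := by
        simp only [h2, Finset.sum_const, Finset.card_univ, Fintype.card_fin, nsmul_eq_mul]
        rw [inv_mul_cancel_left₀ hM', mul_assoc]

open Classical in
/-- A decoding error means that the codeword sent fails the test or a competitor passes it. -/
lemma codebookCode_error_le (ch : Channel X S Y Z) (f : X → Z → Shat) (P : X → ℝ) (γ : ℝ)
    (hM : 0 < M) (C : Fin M → Fin n → X) (w : Fin M) (s : Fin n → S) (y : Fin n → Y) :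
    (if (codebookCode ch f P γ hM C).dec y s ≠ w then (1 : ℝ) else 0) ≤
      (if Passes ch P γ (C w) s y then 0 else 1) +
        ∑ v ∈ Finset.univ.erase w, if Passes ch P γ (C v) s y then 1 else 0 := by
  have h0 : ∀ v ∈ Finset.univ.erase w,
      (0 : ℝ) ≤ if Passes ch P γ (C v) s y then 1 else 0 := fun v _ => by
    split_ifs <;> norm_num
  by_cases hw : Passes ch P γ (C w) s y
  · have hex : ∃ v, Passes ch P γ (C v) s y := ⟨w, hw⟩
    have hdec : (codebookCode ch f P γ hM C).dec y s = hex.choose := dif_pos hex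
    rw [hdec, if_pos hw, zero_add]
    by_cases h : hex.choose = w
    · simp [h]
    · rw [if_pos h]
      have := Finset.single_le_sum h0 (Finset.mem_erase.2 ⟨h, Finset.mem_univ _⟩)
      rwa [if_pos hex.choose_spec] at this
  · rw [if_neg hw]
    have := Finset.sum_nonneg h0
    split_ifs <;> linarith

lemma codebookCode_errorProb (ch : Channel X S Y Z) (f : X → Z → Shat) (P : X → ℝ) (γ : ℝ)
    (hM : 0 < M) (C : Fin M → Fin n → X) :
    (codebookCode ch f P γ hM C).errorProb ch = (M : ℝ)⁻¹ * ∑ w, ∑ s, ∑ y,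
      (∏ i, ch.stateLaw (s i)) * ((∏ i, outputLaw ch (C w i) (s i) (y i)) *
        if (codebookCode ch f P γ hM C).dec y s ≠ w then 1 else 0) := by
  classical
  rw [Code.errorProb_eq, Code.expect]
  simp only [Finset.mul_sum]
  refine Finset.sum_congr rfl fun w _ => Finset.sum_congr rfl fun s _ =>
    Finset.sum_congr rfl fun y _ => ?_
  simp only [outputLaw]
  rw [← sum_pi_prod fun i z => ch.trans (C w i) (s i) (y i, z), Finset.sum_mul, Finset.mul_sum,
    Finset.mul_sum]
  refine Finset.sum_congr rfl fun z _ => ?_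
  simp only [Code.law, Code.input, mul_assoc]
  rfl

/-- The moment generating function, per letter, of `γ - log (P_{Y|XS} / P_{Y|S})`. -/
def tiltedMass (ch : Channel X S Y Z) (P : X → ℝ) (γ t : ℝ) : ℝ :=
  ∑ a : S × Y × X, ch.stateLaw a.1 * (P a.2.2 * outputLaw ch a.2.2 a.1 a.2.1) *
    Real.exp (t * (γ - Real.log (outputLaw ch a.2.2 a.1 a.2.1 / outputMix ch P a.1 a.2.1)))

lemma sum_letterLaw_mul (ch : Channel X S Y Z) (P : X → ℝ) (F : X → S → Y → ℝ) :
    ∑ a : S × Y × X, ch.stateLaw a.1 * (P a.2.2 * outputLaw ch a.2.2 a.1 a.2.1) *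
      F a.2.2 a.1 a.2.1 =
      ∑ x, P x * ∑ s, ch.stateLaw s * ∑ y, outputLaw ch x s y * F x s y := by
  simp only [Fintype.sum_prod_type, Finset.mul_sum]
  calc _ = ∑ s, ∑ x, ∑ y, ch.stateLaw s * (P x * outputLaw ch x s y) * F x s y :=
        Finset.sum_congr rfl fun s _ => Finset.sum_comm
    _ = ∑ x, ∑ s, ∑ y, ch.stateLaw s * (P x * outputLaw ch x s y) * F x s y := Finset.sum_comm
    _ = _ := Finset.sum_congr rfl fun x _ => Finset.sum_congr rfl fun s _ =>
        Finset.sum_congr rfl fun y _ => by ring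

lemma tiltedMass_nonneg (ch : Channel X S Y Z) {P : X → ℝ} (hP : P ∈ stdSimplex ℝ X) (γ t : ℝ) :
    0 ≤ tiltedMass ch P γ t :=
  Finset.sum_nonneg fun _ _ => mul_nonneg (mul_nonneg (ch.stateLaw_nonneg _)
    (mul_nonneg (hP.1 _) (outputLaw_nonneg ch _ _ _))) (Real.exp_pos _).le

/-- Below the mutual information some tilt gains: the derivative at `t = 0` is `γ - I(X;Y|S)`. -/
lemma exists_tiltedMass_lt_one (ch : Channel X S Y Z) {P : X → ℝ} (hP : P ∈ stdSimplex ℝ X)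
    {γ : ℝ} (hγ : γ < infoNats ch P) : ∃ t, 0 < t ∧ tiltedMass ch P γ t < 1 := by
  have hone : ∀ r : ℝ, ∑ x, P x * ∑ s, ch.stateLaw s * ∑ y, outputLaw ch x s y * r = r := by
    intro r
    simp only [← Finset.sum_mul, sum_outputLaw, ch.sum_stateLaw, hP.2, one_mul]
  have h0 : tiltedMass ch P γ 0 = 1 := by
    have := sum_letterLaw_mul ch P fun _ _ _ => 1
    rw [hone] at this
    simpa [tiltedMass] using this
  have hder : HasDerivAt (tiltedMass ch P γ) (γ - infoNats ch P) 0 := by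
    have : HasDerivAt (tiltedMass ch P γ) (∑ a : S × Y × X,
        ch.stateLaw a.1 * (P a.2.2 * outputLaw ch a.2.2 a.1 a.2.1) *
        (γ - Real.log (outputLaw ch a.2.2 a.1 a.2.1 / outputMix ch P a.1 a.2.1))) 0 := by
      refine HasDerivAt.fun_sum fun a _ => HasDerivAt.const_mul _ ?_
      have := ((hasDerivAt_id (0 : ℝ)).mul_const (γ - Real.log (outputLaw ch a.2.2 a.1 a.2.1 /
        outputMix ch P a.1 a.2.1))).exp
      simpa using this
    rw [sum_letterLaw_mul ch P fun x s y =>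
      γ - Real.log (outputLaw ch x s y / outputMix ch P s y)] at this
    simp only [mul_sub, Finset.sum_sub_distrib, hone] at this
    exact this
  have hev := (hasDerivAt_iff_tendsto_slope.1 hder).eventually_lt_const (sub_neg.2 hγ)
  have hev' : ∀ᶠ t in 𝓝[>] (0 : ℝ), slope (tiltedMass ch P γ) 0 t < 0 :=
    hev.filter_mono (nhdsWithin_mono _ fun t ht => ne_of_gt ht)
  obtain ⟨t, ht, htpos⟩ := (hev'.and self_mem_nhdsWithin).exists
  refine ⟨t, htpos, ?_⟩
  rw [slope_def_field, h0, sub_zero, div_lt_iff₀ htpos, zero_mul] at ht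
  linarith

open Classical in
/-- Chernoff's bound for the event that the codeword sent fails the threshold test. -/
lemma sum_not_passes_le (ch : Channel X S Y Z) {P : X → ℝ} (hP : P ∈ stdSimplex ℝ X) (γ : ℝ)
    {t : ℝ} (ht : 0 < t) :
    ∑ s : Fin n → S, ∑ y : Fin n → Y, (∏ i, ch.stateLaw (s i)) * ∑ x : Fin n → X,
      (∏ i, P (x i)) * ((∏ i, outputLaw ch (x i) (s i) (y i)) *
        if Passes ch P γ x s y then 0 else 1) ≤ tiltedMass ch P γ t ^ n := by
  have hpow : tiltedMass ch P γ t ^ n = ∑ s : Fin n → S, ∑ y : Fin n → Y, ∑ x : Fin n → X,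
      ∏ i, (ch.stateLaw (s i) * (P (x i) * outputLaw ch (x i) (s i) (y i)) *
        Real.exp (t * (γ - Real.log (outputLaw ch (x i) (s i) (y i) /
          outputMix ch P (s i) (y i))))) := by
    rw [sum_sequences, sum_pi_prod (ι := Fin n) fun _ (a : S × Y × X) =>
      ch.stateLaw a.1 * (P a.2.2 * outputLaw ch a.2.2 a.1 a.2.1) *
        Real.exp (t * (γ - Real.log (outputLaw ch a.2.2 a.1 a.2.1 / outputMix ch P a.1 a.2.1)))]
    simp [tiltedMass]
  rw [hpow]
  refine Finset.sum_le_sum fun s _ => Finset.sum_le_sum fun y _ => ?_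
  rw [Finset.mul_sum]
  refine Finset.sum_le_sum fun x _ => ?_
  rw [Finset.prod_mul_distrib, Finset.prod_mul_distrib, Finset.prod_mul_distrib,
    ← mul_assoc (∏ i, P (x i)), ← mul_assoc (∏ i, ch.stateLaw (s i)), ← Real.exp_sum]
  have hS : 0 ≤ ∏ i, ch.stateLaw (s i) := Finset.prod_nonneg fun _ _ => ch.stateLaw_nonneg _
  have hPW : 0 ≤ (∏ i, P (x i)) * ∏ i, outputLaw ch (x i) (s i) (y i) :=
    mul_nonneg (Finset.prod_nonneg fun _ _ => hP.1 _)
      (Finset.prod_nonneg fun _ _ => outputLaw_nonneg ch _ _ _)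
  rcases hPW.eq_or_lt with h | h
  · rw [← h]
    simp
  refine mul_le_mul_of_nonneg_left ?_ (mul_nonneg hS hPW)
  split_ifs with hp
  · exact (Real.exp_pos _).le
  have hne := h.ne'
  have hPi : ∀ i, 0 < P (x i) := fun i => (hP.1 _).lt_of_ne'
    (Finset.prod_ne_zero_iff.1 (left_ne_zero_of_mul hne) i (Finset.mem_univ i))
  have hWi : ∀ i, 0 < outputLaw ch (x i) (s i) (y i) := fun i =>
    (outputLaw_nonneg ch _ _ _).lt_of_ne'
      (Finset.prod_ne_zero_iff.1 (right_ne_zero_of_mul hne) i (Finset.mem_univ i))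
  have hqi : ∀ i, 0 < outputMix ch P (s i) (y i) := fun i => outputMix_pos ch hP (hPi i) (hWi i)
  rw [← Finset.mul_sum, Finset.sum_sub_distrib]
  refine Real.one_le_exp (mul_nonneg ht.le (sub_nonneg.2 ?_))
  have hlog := Real.log_le_log (Finset.prod_pos fun i _ => hWi i) (not_lt.1 hp)
  rw [Real.log_mul (Real.exp_pos _).ne' (Finset.prod_pos fun i _ => hqi i).ne', Real.log_exp,
    Real.log_prod fun i _ => (hWi i).ne', Real.log_prod fun i _ => (hqi i).ne'] at hlog
  simp only [Real.log_div (hWi _).ne' (hqi _).ne', Finset.sum_sub_distrib]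
  simp
  linarith

lemma sum_iid_mul_prod_outputLaw (ch : Channel X S Y Z) (P : X → ℝ) (s : Fin n → S)
    (y : Fin n → Y) :
    ∑ x : Fin n → X, (∏ i, P (x i)) * ∏ i, outputLaw ch (x i) (s i) (y i) =
      ∏ i, outputMix ch P (s i) (y i) := by
  classical
  simp only [← Finset.prod_mul_distrib]
  exact sum_pi_prod fun i x => P x * outputLaw ch x (s i) (y i)

lemma sum_prod_outputMix (ch : Channel X S Y Z) {P : X → ℝ} (hP : P ∈ stdSimplex ℝ X) :
    ∑ s : Fin n → S, ∑ y : Fin n → Y,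
      (∏ i, ch.stateLaw (s i)) * ∏ i, outputMix ch P (s i) (y i) = 1 := by
  classical
  have hy : ∀ s : Fin n → S, ∑ y : Fin n → Y, ∏ i, outputMix ch P (s i) (y i) = 1 := fun s => by
    rw [sum_pi_prod fun i => outputMix ch P (s i)]
    simp [sum_outputMix ch hP]
  simp only [← Finset.mul_sum, hy, mul_one]
  rw [sum_pi_prod fun _ => ch.stateLaw]
  simp [ch.sum_stateLaw]

open Classical in
/-- A codeword independent of the output passes the test with probability at most `exp (-n γ)`. -/
lemma outputMix_mul_sum_passes_le (ch : Channel X S Y Z) {P : X → ℝ} (hP : P ∈ stdSimplex ℝ X)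
    (γ : ℝ) (s : Fin n → S) (y : Fin n → Y) :
    (∏ i, outputMix ch P (s i) (y i)) * ∑ x : Fin n → X,
      (∏ i, P (x i)) * (if Passes ch P γ x s y then 1 else 0) ≤
      Real.exp (-(n * γ)) * ∏ i, outputMix ch P (s i) (y i) := by
  conv_rhs => rw [← sum_iid_mul_prod_outputLaw ch P s y, Finset.mul_sum]
  rw [Finset.mul_sum]
  refine Finset.sum_le_sum fun x _ => ?_
  rw [mul_left_comm, mul_left_comm (Real.exp _)]
  refine mul_le_mul_of_nonneg_left ?_ (Finset.prod_nonneg fun _ _ => hP.1 _)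
  split_ifs with hp
  · rw [mul_one, Real.exp_neg, ← div_eq_inv_mul, le_div_iff₀ (Real.exp_pos _), mul_comm]
    exact le_of_lt hp
  · rw [mul_zero]
    exact mul_nonneg (Real.exp_pos _).le (Finset.prod_nonneg fun _ _ => outputLaw_nonneg ch _ _ _)

/-- The expected error probability of a random codebook. -/
lemma sum_codebookLaw_mul_errorProb_le (ch : Channel X S Y Z) (f : X → Z → Shat) {P : X → ℝ}
    (hP : P ∈ stdSimplex ℝ X) (γ : ℝ) {t : ℝ} (ht : 0 < t) (hM : 0 < M) :
    ∑ C : Fin M → Fin n → X, codebookLaw P C * (codebookCode ch f P γ hM C).errorProb ch ≤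
      tiltedMass ch P γ t ^ n + M * Real.exp (-(n * γ)) := by
  classical
  have hM' : (M : ℝ) ≠ 0 := Nat.cast_ne_zero.2 hM.ne'
  -- the average over the codebook, for fixed message, states and outputs
  have hfix : ∀ (w : Fin M) (s : Fin n → S) (y : Fin n → Y),
      ∑ C : Fin M → Fin n → X, codebookLaw P C * ((∏ i, outputLaw ch (C w i) (s i) (y i)) *
        if (codebookCode ch f P γ hM C).dec y s ≠ w then 1 else 0) ≤
      ∑ x : Fin n → X, (∏ i, P (x i)) * ((∏ i, outputLaw ch (x i) (s i) (y i)) *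
        if Passes ch P γ x s y then 0 else 1) +
      M * (Real.exp (-(n * γ)) * ∏ i, outputMix ch P (s i) (y i)) := by
    intro w s y
    calc _ ≤ ∑ C : Fin M → Fin n → X, (codebookLaw P C *
          ((∏ i, outputLaw ch (C w i) (s i) (y i)) * (if Passes ch P γ (C w) s y then 0 else 1)) +
          ∑ v ∈ Finset.univ.erase w, codebookLaw P C * ((∏ i, outputLaw ch (C w i) (s i) (y i)) *
            if Passes ch P γ (C v) s y then 1 else 0)) := by
          refine Finset.sum_le_sum fun C _ => ?_
          rw [← Finset.mul_sum, ← Finset.mul_sum, ← mul_add, ← mul_add]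
          exact mul_le_mul_of_nonneg_left (mul_le_mul_of_nonneg_left
            (codebookCode_error_le ch f P γ hM C w s y)
            (Finset.prod_nonneg fun _ _ => outputLaw_nonneg ch _ _ _)) (codebookLaw_nonneg hP C)
      _ = ∑ x : Fin n → X, (∏ i, P (x i)) * ((∏ i, outputLaw ch (x i) (s i) (y i)) *
            if Passes ch P γ x s y then 0 else 1) +
          ∑ v ∈ Finset.univ.erase w, (∏ i, outputMix ch P (s i) (y i)) * ∑ x : Fin n → X,
            (∏ i, P (x i)) * (if Passes ch P γ x s y then 1 else 0) := by
          rw [Finset.sum_add_distrib]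
          congr 1
          · exact sum_iid_apply (q := fun x : Fin n → X => ∏ i, P (x i)) (sum_prod_eq_one hP) w
              fun x => (∏ i, outputLaw ch (x i) (s i) (y i)) *
                if Passes ch P γ x s y then 0 else 1
          · rw [Finset.sum_comm]
            refine Finset.sum_congr rfl fun v hv => ?_
            rw [← sum_iid_mul_prod_outputLaw ch P s y]
            exact sum_iid_apply₂ (q := fun x : Fin n → X => ∏ i, P (x i)) (sum_prod_eq_one hP)
              (Finset.ne_of_mem_erase hv).symm (fun x => ∏ i, outputLaw ch (x i) (s i) (y i))
              fun x => if Passes ch P γ x s y then 1 else 0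
      _ ≤ _ := by
          refine add_le_add le_rfl ((Finset.sum_le_sum fun v _ =>
            outputMix_mul_sum_passes_le ch hP γ s y).trans ?_)
          rw [Finset.sum_const, nsmul_eq_mul]
          refine mul_le_mul_of_nonneg_right ?_ (mul_nonneg (Real.exp_pos _).le
            (Finset.prod_nonneg fun _ _ => outputMix_nonneg ch hP _ _))
          exact_mod_cast (Finset.card_erase_le.trans_eq (by simp))
  calc _ = (M : ℝ)⁻¹ * ∑ w : Fin M, ∑ s : Fin n → S, ∑ y : Fin n → Y,
        (∏ i, ch.stateLaw (s i)) * ∑ C : Fin M → Fin n → X, codebookLaw P C *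
          ((∏ i, outputLaw ch (C w i) (s i) (y i)) *
            if (codebookCode ch f P γ hM C).dec y s ≠ w then 1 else 0) := by
        simp only [codebookCode_errorProb, Finset.mul_sum]
        rw [Finset.sum_comm]
        refine Finset.sum_congr rfl fun w _ => ?_
        rw [Finset.sum_comm]
        refine Finset.sum_congr rfl fun s _ => ?_
        rw [Finset.sum_comm]
        refine Finset.sum_congr rfl fun y _ => Finset.sum_congr rfl fun C _ => ?_
        ring
    _ ≤ (M : ℝ)⁻¹ * ∑ w : Fin M, ∑ s : Fin n → S, ∑ y : Fin n → Y,
        (∏ i, ch.stateLaw (s i)) * (∑ x : Fin n → X, (∏ i, P (x i)) *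
          ((∏ i, outputLaw ch (x i) (s i) (y i)) * if Passes ch P γ x s y then 0 else 1) +
          M * (Real.exp (-(n * γ)) * ∏ i, outputMix ch P (s i) (y i))) :=
        mul_le_mul_of_nonneg_left (Finset.sum_le_sum fun w _ => Finset.sum_le_sum fun s _ =>
          Finset.sum_le_sum fun y _ => mul_le_mul_of_nonneg_left (hfix w s y)
            (Finset.prod_nonneg fun _ _ => ch.stateLaw_nonneg _)) (by positivity)
    _ = (∑ s : Fin n → S, ∑ y : Fin n → Y, (∏ i, ch.stateLaw (s i)) * ∑ x : Fin n → X,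
          (∏ i, P (x i)) * ((∏ i, outputLaw ch (x i) (s i) (y i)) *
            if Passes ch P γ x s y then 0 else 1)) + M * Real.exp (-(n * γ)) := by
        rw [Finset.sum_const, Finset.card_univ, Fintype.card_fin, nsmul_eq_mul,
          inv_mul_cancel_left₀ hM']
        simp only [mul_add, Finset.sum_add_distrib]
        congr 1
        rw [← mul_one (M * Real.exp (-(n * γ))), ← sum_prod_outputMix ch hP]
        simp only [Finset.mul_sum]
        exact Finset.sum_congr rfl fun s _ => Finset.sum_congr rfl fun y _ => by ring
    _ ≤ _ := add_le_add (sum_not_passes_le ch hP γ ht) le_rfl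

/-- Some codebook is good for the combined objective "distortion plus `K` times error". -/
lemma exists_codebook (ch : Channel X S Y Z) {d : S → Shat → ℝ} (hd : ∀ s a, 0 ≤ d s a)
    (f : X → Z → Shat) {P : X → ℝ} (hP : P ∈ stdSimplex ℝ X) (γ : ℝ) (hM : 0 < M) {K ε : ℝ}
    (hK : 0 ≤ K)
    (hε : ∑ C : Fin M → Fin n → X, codebookLaw P C *
      (codebookCode ch f P γ hM C).errorProb ch ≤ ε) :
    ∃ C : Fin M → Fin n → X, (codebookCode ch f P γ hM C).distortion ch d +
      K * (codebookCode ch f P γ hM C).errorProb ch ≤ ∑ x, P x * inputCost ch d f x + K * ε := by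
  by_contra! hcon
  have hcost : 0 ≤ ∑ x, P x * inputCost ch d f x := Finset.sum_nonneg fun x _ =>
    mul_nonneg (hP.1 x) (Finset.sum_nonneg fun s _ => mul_nonneg (ch.stateLaw_nonneg s)
      (Finset.sum_nonneg fun y _ => Finset.sum_nonneg fun z _ =>
        mul_nonneg (ch.trans_nonneg _ _ _) (hd _ _)))
  set B := ∑ x, P x * inputCost ch d f x + K * ε with hB
  have hle : ∑ C : Fin M → Fin n → X, codebookLaw P C *
      ((codebookCode ch f P γ hM C).distortion ch d +
        K * (codebookCode ch f P γ hM C).errorProb ch) ≤ B := by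
    simp only [mul_add, Finset.sum_add_distrib]
    refine add_le_add ?_ ?_
    · rw [sum_codebookLaw_mul_distortion ch d f hP]
      exact mul_le_of_le_one_left hcost inv_mul_le_one
    · simp only [mul_left_comm _ K, ← Finset.mul_sum]
      exact mul_le_mul_of_nonneg_left hε hK
  have hpos : ∃ C : Fin M → Fin n → X, 0 < codebookLaw P C := by
    by_contra! h
    have := Finset.sum_nonpos fun (C : Fin M → Fin n → X) (_ : C ∈ Finset.univ) => h C
    rw [sum_codebookLaw hP] at this
    linarith
  obtain ⟨C₀, hC₀⟩ := hpos
  have hlt : ∑ C : Fin M → Fin n → X, codebookLaw P C * B < ∑ C : Fin M → Fin n → X,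
      codebookLaw P C * ((codebookCode ch f P γ hM C).distortion ch d +
        K * (codebookCode ch f P γ hM C).errorProb ch) :=
    Finset.sum_lt_sum
      (fun C _ => mul_le_mul_of_nonneg_left (hcon C).le (codebookLaw_nonneg hP C))
      ⟨C₀, Finset.mem_univ _, mul_lt_mul_of_pos_left (hcon C₀) hC₀⟩
  rw [← Finset.sum_mul, sum_codebookLaw hP, one_mul] at hlt
  linarith

end RandomCoding

/-! ### Achievability -/

section Achievability

variable {X S Y Z Shat : Type*} [Fintype S] [Fintype Y] [Fintype Z]

/-- Codes with `distortion + n * errorProb ≤ D + n ε_n`, where `n ε_n → 0`, achieve `(R, D)`: the weight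
`n` forces the error to vanish, and the distortion exceeds `D` by at most `n ε_n`. -/
lemma achievable_of_codes (ch : Channel X S Y Z) {d : S → Shat → ℝ} (hd : ∀ s a, 0 ≤ d s a)
    {R D : ℝ} (hR : 0 ≤ R) {ε : ℕ → ℝ} (hε : Tendsto (fun n : ℕ => n * ε n) atTop (𝓝 0))
    (h : ∀ n : ℕ, ∃ c : Code X S Y Z Shat n ⌊(2 : ℝ) ^ ((n : ℝ) * R)⌋₊,
      c.distortion ch d + n * c.errorProb ch ≤ D + n * ε n) : Achievable ch d R D := by
  choose c hc using h
  have hdist : ∀ n, (c n).distortion ch d ≤ D + n * ε n := fun n => by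
    have := mul_nonneg (Nat.cast_nonneg n : (0 : ℝ) ≤ n) ((c n).errorProb_nonneg ch)
    linarith [hc n]
  have hlim : Tendsto (fun n : ℕ => D + n * ε n) atTop (𝓝 D) := by
    simpa using hε.const_add D
  refine ⟨hR, c, ?_, ?_⟩
  · have h0 : Tendsto (fun n : ℕ => (n : ℝ)⁻¹ * (D + n * ε n)) atTop (𝓝 0) := by
      simpa using tendsto_inv_atTop_nhds_zero_nat.mul hlim
    refine squeeze_zero' (Eventually.of_forall fun n => (c n).errorProb_nonneg ch) ?_ h0
    filter_upwards [eventually_gt_atTop 0] with n hn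
    rw [← div_eq_inv_mul, le_div_iff₀ (Nat.cast_pos.2 hn), mul_comm]
    linarith [hc n, (c n).distortion_nonneg ch hd]
  · rw [← hlim.limsup_eq]
    exact limsup_le_limsup (Eventually.of_forall hdist)
      (isBoundedUnder_of ⟨0, fun n => (c n).distortion_nonneg ch hd⟩).isCoboundedUnder_le
      hlim.isBoundedUnder_le

/-- A single message is never decoded wrongly. -/
lemma Code.errorProb_eq_zero {n M : ℕ} (c : Code X S Y Z Shat n M) (ch : Channel X S Y Z)
    (hM : M = 1) : c.errorProb ch = 0 := by
  subst hM
  exact Finset.sum_eq_zero fun w _ => Finset.sum_eq_zero fun s _ => Finset.sum_eq_zero fun y _ =>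
    Finset.sum_eq_zero fun z _ => if_neg (not_not.2 (Subsingleton.elim _ _))

variable [Fintype X]

lemma achievable_zero (ch : Channel X S Y Z) {d : S → Shat → ℝ} (hd : ∀ s a, 0 ≤ d s a)
    (f : X → Z → Shat) {D : ℝ} {P : X → ℝ} (hP : P ∈ stdSimplex ℝ X)
    (hcost : ∑ x, P x * inputCost ch d f x ≤ D) : Achievable ch d 0 D := by
  refine achievable_of_codes ch hd le_rfl (ε := fun _ => 0) (by simp) fun n => ?_
  have hM : ⌊(2 : ℝ) ^ ((n : ℝ) * 0)⌋₊ = 1 := by simp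
  obtain ⟨C, hC⟩ := exists_codebook (n := n) ch hd f hP 0 (one_le_messageCount le_rfl n)
    (n.cast_nonneg : (0 : ℝ) ≤ n) (ε := 0)
    (Finset.sum_eq_zero fun C _ => by rw [Code.errorProb_eq_zero _ ch hM, mul_zero]).le
  exact ⟨_, hC.trans (add_le_add hcost le_rfl)⟩

theorem achievable_of_lt_infoNats (ch : Channel X S Y Z) {d : S → Shat → ℝ}
    (hd : ∀ s a, 0 ≤ d s a) (f : X → Z → Shat) {R D : ℝ} {P : X → ℝ} (hP : P ∈ stdSimplex ℝ X)
    (hcost : ∑ x, P x * inputCost ch d f x ≤ D) (hR : 0 ≤ R)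
    (hlt : R < infoNats ch P / Real.log 2) : Achievable ch d R D := by
  rw [lt_div_iff₀ (Real.log_pos (by norm_num))] at hlt
  obtain ⟨γ, hRγ, hγ⟩ := exists_between hlt
  obtain ⟨t, ht, hψ⟩ := exists_tiltedMass_lt_one ch hP hγ
  have hexp : Real.exp (R * Real.log 2 - γ) < 1 := by
    rw [← Real.exp_zero]
    exact Real.exp_lt_exp.2 (by linarith)
  refine achievable_of_codes ch hd hR
    (ε := fun n => tiltedMass ch P γ t ^ n + Real.exp (R * Real.log 2 - γ) ^ n) ?_ fun n => ?_
  · have := (tendsto_self_mul_const_pow_of_lt_one (tiltedMass_nonneg ch hP γ t) hψ).add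
      (tendsto_self_mul_const_pow_of_lt_one (Real.exp_pos _).le hexp)
    simpa only [mul_add, add_zero] using this
  · have hM : 0 < ⌊(2 : ℝ) ^ ((n : ℝ) * R)⌋₊ := one_le_messageCount hR n
    have hcount : (⌊(2 : ℝ) ^ ((n : ℝ) * R)⌋₊ : ℝ) * Real.exp (-(n * γ)) ≤
        Real.exp (R * Real.log 2 - γ) ^ n := by
      rw [← Real.exp_nat_mul, mul_sub, sub_eq_add_neg, Real.exp_add]
      refine mul_le_mul_of_nonneg_right ((Nat.floor_le (by positivity)).trans_eq ?_)
        (Real.exp_pos _).le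
      rw [Real.rpow_def_of_pos (by norm_num)]
      ring_nf
    obtain ⟨C, hC⟩ := exists_codebook ch hd f hP γ hM (n.cast_nonneg : (0 : ℝ) ≤ n)
      ((sum_codebookLaw_mul_errorProb_le ch f hP γ ht hM).trans (add_le_add le_rfl hcount))
    exact ⟨_, hC.trans (add_le_add hcost le_rfl)⟩

end Achievability

/-! ### The capacity-distortion tradeoff -/

section Tradeoff

variable {X S Y Z Shat : Type*} [Fintype X] [Fintype S] [Fintype Y] [Fintype Z] [Fintype Shat]

lemma Achievable.nonempty_estimate {X S Y Z Shat : Type*} [Fintype S] [Fintype Y]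
    [Fintype Z] {ch : Channel X S Y Z} {d : S → Shat → ℝ} {R D : ℝ}
    (h : Achievable ch d R D) (x : X) (z : Z) : Nonempty Shat :=
  let ⟨_, c, _⟩ := h
  ⟨(c 1).est (fun _ => x) (fun _ => z) 0⟩

lemma feasible_deterministicKernel (ch : Channel X S Y Z) (d : S → Shat → ℝ) {D : ℝ}
    (f : X → Z → Shat) {P : X → ℝ} (hP : P ∈ stdSimplex ℝ X)
    (hcost : ∑ x, P x * inputCost ch d f x ≤ D) :
    Feasible ch d D P (deterministicKernel f) :=
  ⟨hP, isEstimatorKernel_deterministicKernel f, by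
    rwa [expectedDistortion_deterministicKernel]⟩

/-- For a Bayes estimator `f`, the least upper bound of the achievable rates is the maximum of
`I(X;Y|S)` over the compact set of input laws that meet the constraint with `f`. -/
theorem exists_optimal_inputLaw (ch : Channel X S Y Z) {d : S → Shat → ℝ}
    (hd : ∀ s a, 0 ≤ d s a) {D : ℝ} {f : X → Z → Shat} (hf : IsBayesEstimator ch d f)
    (hne : ∃ P ∈ stdSimplex ℝ X, ∑ x, P x * inputCost ch d f x ≤ D) :
    ∃ P ∈ stdSimplex ℝ X, ∑ x, P x * inputCost ch d f x ≤ D ∧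
      (∀ P' ∈ stdSimplex ℝ X, ∑ x, P' x * inputCost ch d f x ≤ D →
        infoNats ch P' ≤ infoNats ch P) ∧
      IsLUB {R : ℝ | Achievable ch d R D} (infoNats ch P / Real.log 2) := by
  have hlog2 : 0 < Real.log 2 := Real.log_pos (by norm_num)
  have hclosed : IsClosed {P : X → ℝ | ∑ x, P x * inputCost ch d f x ≤ D} :=
    isClosed_le (continuous_finsetSum _ fun x _ => (continuous_apply x).mul continuous_const)
      continuous_const
  obtain ⟨P, ⟨hP, hcost⟩, hmax⟩ := ((isCompact_stdSimplex ℝ X).inter_right hclosed).exists_isMaxOn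
    hne ((continuousOn_infoNats ch).mono Set.inter_subset_left)
  refine ⟨P, hP, hcost, fun P' hP' hc' => hmax ⟨hP', hc'⟩, fun R hR => ?_, fun b hb => ?_⟩
  · obtain ⟨P', hP', hc', hle⟩ := Achievable.exists_inputLaw hd hR hf
    exact hle.trans (div_le_div_of_nonneg_right (hmax ⟨hP', hc'⟩) hlog2.le)
  · refine le_of_forall_lt_imp_le_of_dense fun R hR => ?_
    rcases le_or_gt R 0 with h0 | h0
    · exact h0.trans (hb (achievable_zero ch hd f hP hcost))
    · exact hb (achievable_of_lt_infoNats ch hd f hP hcost h0.le hR)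

end Tradeoff

end JointSensing
end

theorem theorem1 {X S Y Z Shat : Type*}
    [Fintype X] [Fintype S] [Fintype Y] [Fintype Z] [Fintype Shat]
    (ch : JointSensing.Channel X S Y Z) (d : S → Shat → ℝ) (hd : ∀ s a, 0 ≤ d s a) (D : ℝ) :
    -- some input law and estimator meet the distortion constraint
    ((∃ (PX : X → ℝ) (Q : X → Z → Shat → ℝ), JointSensing.Feasible ch d D PX Q) →
      -- `C(D)` is a genuine supremum of achievable rates
      IsLUB {R : ℝ | JointSensing.Achievable ch d R D}
        (JointSensing.capacityDistortion ch d D) ∧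
      -- `C(D) = max I(X;Y|S)`, and the maximum is attained
      IsGreatest {I : ℝ | ∃ (PX : X → ℝ) (Q : X → Z → Shat → ℝ),
          JointSensing.Feasible ch d D PX Q ∧ I = JointSensing.mutualInfoXYgivenS ch PX Q}
        (JointSensing.capacityDistortion ch d D) ∧
      -- a deterministic Bayes estimator exists, and any such estimator gives the same maximum
      (∃ f : X → Z → Shat, JointSensing.IsBayesEstimator ch d f) ∧
      ∀ f : X → Z → Shat, JointSensing.IsBayesEstimator ch d f →
        IsGreatest {I : ℝ | ∃ PX : X → ℝ,
            JointSensing.Feasible ch d D PX (JointSensing.deterministicKernel f) ∧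
            I = JointSensing.mutualInfoXYgivenS ch PX (JointSensing.deterministicKernel f)}
          (JointSensing.capacityDistortion ch d D)) ∧
    -- if the constraint cannot be met, no rate at all is achievable
    ((¬ ∃ (PX : X → ℝ) (Q : X → Z → Shat → ℝ), JointSensing.Feasible ch d D PX Q) →
      ∀ R : ℝ, ¬ JointSensing.Achievable ch d R D) := by
  open JointSensing in
  have hlog2 : 0 < Real.log 2 := Real.log_pos (by norm_num)
  refine ⟨?_, fun hno R hR => ?_⟩
  · rintro ⟨P₀, Q₀, hP₀, hQ₀, hD₀⟩
    have hex : ∃ f : X → Z → Shat, IsBayesEstimator ch d f :=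
      exists_isBayesEstimator ch d fun x z => by
        by_contra h
        have := (hQ₀ x z).2
        rw [not_nonempty_iff] at h
        simp at this
    have hmain : ∀ f : X → Z → Shat, IsBayesEstimator ch d f →
        ∃ P ∈ stdSimplex ℝ X, ∑ x, P x * inputCost ch d f x ≤ D ∧
          (∀ P' ∈ stdSimplex ℝ X, ∑ x, P' x * inputCost ch d f x ≤ D →
            infoNats ch P' ≤ infoNats ch P) ∧
          IsLUB {R : ℝ | Achievable ch d R D} (infoNats ch P / Real.log 2) ∧
          capacityDistortion ch d D = infoNats ch P / Real.log 2 := by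
      intro f hf
      obtain ⟨P, hP, hcost, hmax, hlub⟩ := exists_optimal_inputLaw ch hd hf
        ⟨P₀, hP₀, (hf.sum_inputCost_le hP₀ hQ₀).trans hD₀⟩
      exact ⟨P, hP, hcost, hmax, hlub,
        hlub.csSup_eq ⟨0, achievable_zero ch hd f hP hcost⟩⟩
    refine ⟨?_, ?_, hex, fun f hf => ?_⟩
    · obtain ⟨f, hf⟩ := hex
      obtain ⟨P, -, -, -, hlub, hC⟩ := hmain f hf
      rwa [hC]
    · obtain ⟨f, hf⟩ := hex
      obtain ⟨P, hP, hcost, hmax, -, hC⟩ := hmain f hf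
      rw [hC]
      refine ⟨⟨P, deterministicKernel f, feasible_deterministicKernel ch d f hP hcost, ?_⟩, ?_⟩
      · rw [mutualInfoXYgivenS_eq ch hP (isEstimatorKernel_deterministicKernel f)]
      · rintro _ ⟨P', Q', ⟨hP', hQ', hD'⟩, rfl⟩
        rw [mutualInfoXYgivenS_eq ch hP' hQ']
        exact div_le_div_of_nonneg_right
          (hmax P' hP' ((hf.sum_inputCost_le hP' hQ').trans hD')) hlog2.le
    · obtain ⟨P, hP, hcost, hmax, -, hC⟩ := hmain f hf
      rw [hC]
      refine ⟨⟨P, feasible_deterministicKernel ch d f hP hcost, ?_⟩, ?_⟩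
      · rw [mutualInfoXYgivenS_eq ch hP (isEstimatorKernel_deterministicKernel f)]
      · rintro _ ⟨P', ⟨hP', hQ', hD'⟩, rfl⟩
        rw [mutualInfoXYgivenS_eq ch hP' hQ']
        exact div_le_div_of_nonneg_right
          (hmax P' hP' ((hf.sum_inputCost_le hP' hQ').trans hD')) hlog2.le
  · obtain ⟨f, hf⟩ := exists_isBayesEstimator ch d hR.nonempty_estimate
    obtain ⟨P, hP, hcost, -⟩ := hR.exists_inputLaw hd hf
    exact hno ⟨P, deterministicKernel f, feasible_deterministicKernel ch d f hP hcost⟩
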